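/- All oriented graphs are finite, without loops and without pairs of opposite edges; $\|H\|$ is the number of edges of $H$. A tournamenton is a bounded measurable function $W:[0,1]^2\to[0,\infty)$ with $W(x,y)+W(y,x)=1$ for all $(x,y)\in[0,1]^2$, and the homomorphism density of an oriented graph $H$ in $W$ is $t(H,W)=\int_{[0,1]^{V(H)}}\prod_{vw\in E(H)}W(x_v,x_w)\,\mathrm{d}x_{V(H)}$. An oriented graph $H$ is quasirandom-forcing if every tournamenton $W$ with $t(H,W)=2^{-\|H\|}$ is equal to $1/2$ almost everywhere. For a positive integer $n$, let $Q_{2n}$ be the path with $2n$ edges, all oriented from its central vertex towards its two end vertices, and for even $\ell\ge 4$ let $D_\ell$ be the cycle of length $\ell$ with all edges oriented in the direction from one of two opposite vertices to the other. For an orientation $C$ of a cycle and positive integers $n_1,\dots,n_k$, let $\alpha_C(2n_1,\dots,2n_k)$ be the number of sets $F\subseteq E(C)$ such that the spanning subgraph of $C$ with edge set $F$ can be obtained, up to isomorphism, from the disjoint union $Q_{2n_1}\cup\cdots\cup Q_{2n_k}$ by reversing an even number of edges and possibly adding isolated vertices, minus the number of such sets $F$ with an odd number of edges reversed instead. If $C$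 has even length $\ell$, let $\gamma_C=+1$ if $C$ can be obtained from $D_\ell$ by reversing an even number of edges, and $\gamma_C=-1$ otherwise. **Theorem.** Let $C$ be an orientation of a cycle of even length $\ell$ (so $\ell\ge 4$). If $\gamma_C=1$, $\alpha_C(2)=0$ and \[\frac{\alpha_C(4)}{2^{\ell-4}}+\sum_{3\le n_1\le \ell/2-1}\frac{\min\{0,\alpha_C(2n_1)\}}{\pi^{2n_1-4}\cdot 2^{\ell-2n_1}}+\sum_{\substack{1\le n_1\le\cdots\le n_k,\ k\ge 2\\ k+2n_1+\cdots+2n_k\le\ell}}\frac{\min\{0,\alpha_C(2n_1,\ldots,2n_k)\}}{12^{k-2}\cdot\pi^{2n_1+\cdots+2n_k-2k}\cdot 2^{\ell-2n_1-\cdots-2n_k}}\ \ge\ 0,\] then $C$ is quasirandom-forcing. Similarly, if $\gamma_C=-1$, $\alpha_C(2)=0$ and \[\frac{\alpha_C(4)}{2^{\ell-4}}+\sum_{3\le n_1\le \ell/2-1}\frac{\max\{0,\alpha_C(2n_1)\}}{\pi^{2n_1-4}\cdot 2^{\ell-2n_1}}+\sum_{\substack{1\le n_1\le\cdots\le n_k,\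 k\ge 2\\ k+2n_1+\cdots+2n_k\le\ell}}\frac{\max\{0,\alpha_C(2n_1,\ldots,2n_k)\}}{12^{k-2}\cdot\pi^{2n_1+\cdots+2n_k-2k}\cdot 2^{\ell-2n_1-\cdots-2n_k}}\ \le\ 0,\] then $C$ is quasirandom-forcing. -/

import Mathlib

open scoped unitInterval

/-- An oriented graph on the vertex set `V`: a digraph in which no two vertices are joined by
edges in both directions; in particular there are no loops and no parallel edges. -/
structure OrientedGraph (V : Type*) extends Digraph V where
  asymm : ∀ v w, Adj v w → ¬ Adj w v

namespace OrientedGraph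

open scoped Classical in
/-- The edge set `E(H)`; the pair `(v, w)` is the edge from `v` to `w`. -/
noncomputable def edgeFinset {V : Type*} [Fintype V] (H : OrientedGraph V) : Finset (V × V) :=
  Finset.univ.filter fun e => H.Adj e.1 e.2

/-- The spanning subgraph `H⟨F⟩` with vertex set `V(H)` and edge set `F` (for `F ⊆ E(H)`). -/
def spanning {V : Type*} (H : OrientedGraph V) (F : Finset (V × V)) : OrientedGraph V where
  Adj v w := H.Adj v w ∧ (v, w) ∈ F
  asymm v w h h2 := H.asymm v w h.1 h2.1

/-- The oriented graph obtained from `H` by reversing the edges in `R` (for `R ⊆ E(H)`). -/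
def reverse {V : Type*} (H : OrientedGraph V) (R : Finset (V × V)) : OrientedGraph V where
  Adj v w := (H.Adj v w ∧ (v, w) ∉ R) ∨ (H.Adj w v ∧ (w, v) ∈ R)
  asymm v w := by
    have := H.asymm v w
    tauto

/-- The disjoint union of a family of oriented graphs. -/
def disjUnion {ι : Type*} {V : ι → Type*} (H : ∀ i, OrientedGraph (V i)) :
    OrientedGraph (Σ i, V i) where
  Adj a b := ∃ i v w, a = ⟨i, v⟩ ∧ b = ⟨i, w⟩ ∧ (H i).Adj v w
  asymm := by
    rintro a b ⟨i, v, w, rfl, rfl, h⟩ ⟨j, x, y, h1, h2, h3⟩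
    cases h1
    cases h2
    exact (H i).asymm v w h h3

/-- `G` is, up to isomorphism, obtained from `H` by adding some (possibly no) isolated vertices:
an injection `f` of the vertices maps the edges of `H` exactly onto the edges of `G`. -/
def IsPadding {V' V : Type*} (H : OrientedGraph V') (G : OrientedGraph V) : Prop :=
  ∃ f : V' ↪ V, ∀ a b, G.Adj a b ↔ ∃ v w, f v = a ∧ f w = b ∧ H.Adj v w

/-- `G` can be obtained from `H` by reversing an even number of edges and possibly adding some
isolated vertices. -/
def EvenReversalOf {V' V : Type*} [Fintype V'] (G : OrientedGraph V) (H : OrientedGraph V') :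
    Prop :=
  ∃ R ⊆ H.edgeFinset, Even R.card ∧ (H.reverse R).IsPadding G

/-- `G` can be obtained from `H` by reversing an odd number of edges and possibly adding some
isolated vertices. -/
def OddReversalOf {V' V : Type*} [Fintype V'] (G : OrientedGraph V) (H : OrientedGraph V') :
    Prop :=
  ∃ R ⊆ H.edgeFinset, Odd R.card ∧ (H.reverse R).IsPadding G

/-- The oriented path `Q_{2n}` with `2 * n` edges: the path `0, 1, …, 2 * n` with all edges
oriented from its central vertex `n` towards its two end vertices. -/
def Q (n : ℕ) : OrientedGraph (Fin (2 * n + 1)) where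
  Adj a b := (n ≤ a.val ∧ b.val = a.val + 1) ∨ (a.val ≤ n ∧ a.val = b.val + 1)
  asymm a b := by omega

/-- The oriented cycle `D_{2m}` on the vertices `0, …, 2 * m - 1`, all edges of which are oriented
in the direction from the vertex `0` to the opposite vertex `m`. -/
def D (m : ℕ) : OrientedGraph (Fin (2 * m)) where
  Adj a b := (a.val < m ∧ b.val = a.val + 1) ∨ (m ≤ b.val ∧ a.val = b.val + 1) ∨
    (a.val = 0 ∧ b.val + 1 = 2 * m)
  asymm a b := by omega

open scoped Classical in
/-- The coefficient `α_C(2n₁, …, 2nₖ)`. -/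
noncomputable def alpha {V : Type*} [Fintype V] (C : OrientedGraph V) {k : ℕ} (n : Fin k → ℕ) :
    ℤ :=
  ((C.edgeFinset.powerset.filter fun F =>
      (C.spanning F).EvenReversalOf (disjUnion fun i => Q (n i))).card : ℤ) -
    ((C.edgeFinset.powerset.filter fun F =>
      (C.spanning F).OddReversalOf (disjUnion fun i => Q (n i))).card : ℤ)

open scoped Classical in
/-- The sign `γ_C` of an orientation `C` of a cycle of even length; the length of the cycle is its
number of vertices, so that `D (Fintype.card V / 2)` is the oriented cycle `D_ℓ`. -/
noncomputable def gamma {V : Type*} [Fintype V] (C : OrientedGraph V) : ℤ :=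
  if C.EvenReversalOf (D (Fintype.card V / 2)) then 1 else -1

/-- `C` is an orientation of a cycle of length `ℓ`. -/
def IsCycleOrientation {V : Type*} (C : OrientedGraph V) (ℓ : ℕ) : Prop :=
  3 ≤ ℓ ∧ Nonempty (C.toDigraph.toSimpleGraphInclusive ≃g SimpleGraph.cycleGraph ℓ)

end OrientedGraph

/-- A kernel: a bounded measurable function from `[0,1]²` to `ℝ`. -/
structure IsKernel (U : I → I → ℝ) : Prop where
  measurable : Measurable fun p : I × I => U p.1 p.2
  bounded : ∃ B : ℝ, ∀ x y, |U x y| ≤ B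

/-- A tournamenton: a non-negative kernel `W` with `W(x,y) + W(y,x) = 1` for all `x, y`. -/
structure IsTournamenton (W : I → I → ℝ) : Prop extends IsKernel W where
  nonneg : ∀ x y, 0 ≤ W x y
  add_swap : ∀ x y, W x y + W y x = 1

namespace OrientedGraph

/-- The homomorphism density `t(H, U)`. -/
noncomputable def homDensity {V : Type*} [Fintype V] (H : OrientedGraph V) (U : I → I → ℝ) : ℝ :=
  ∫ x : V → I, ∏ e ∈ H.edgeFinset, U (x e.1) (x e.2)

/-- `H` is quasirandom-forcing: every tournamenton `W` with `t(H, W) = 2^{-‖H‖}` is equal to `1/2`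
almost everywhere. -/
def QuasirandomForcing {V : Type*} [Fintype V] (H : OrientedGraph V) : Prop :=
  ∀ W : I → I → ℝ, IsTournamenton W → H.homDensity W = 1 / 2 ^ H.edgeFinset.card →
    ∀ᵐ p : I × I, W p.1 p.2 = 1 / 2

end OrientedGraph

open scoped Classical in
/-- The finite set of all tuples `1 ≤ n₁ ≤ ⋯ ≤ nₖ` with `k + 2n₁ + ⋯ + 2nₖ ≤ ℓ`. -/
noncomputable def pathTuples (ℓ k : ℕ) : Finset (Fin k → ℕ) :=
  (Fintype.piFinset fun _ : Fin k => Finset.Icc 1 ℓ).filter fun n =>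
    Monotone n ∧ k + ∑ i, 2 * n i ≤ ℓ

open MeasureTheory

/-! ### The Fourier series of `|sin|` -/

/-! Write W = 1/2 + U, so that U is antisymmetric with |U| ≤ 1/2, and let T be the integral operator
of U. Multiplying out the product over the edges of C turns t(C,W) into the sum of
t(C⟨F⟩,U)/2^(ℓ-|F|) over F ⊆ E(C). The empty set gives 2^(-ℓ) and the full set gives γ_C t(D_ℓ,U).
Every other F spans a disjoint union of paths: antisymmetry kills any path of odd length, and if all
lengths are even the density is, up to sign, a product of numbers t_n = t(Q_{2n},U) = ‖Tⁿ1‖².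
Collecting signs yields the coefficients α_C (`homDensity_cycle_eq`).

Three bounds control the path terms: t_{n+j} ≤ t_n/π^(2j), since T has norm at most 1/π
(`integral_kernelOp_sq_le`); t_1² ≤ t_2, by Cauchy-Schwarz; and t_1 ≤ 1/12. As α_C(2) = 0, they show
that γ_C times the path sum is at least t_2 times γ_C times the expression in the hypothesis, hence
nonnegative (`sum_mul_prod_nonneg`).

Finally t(D_ℓ,U) is the squared Hilbert-Schmidt norm of T^(ℓ/2) (`homDensity_D`). If t(C,W) =
2^(-ℓ), two nonnegative numbers sum to zero, so T^(ℓ/2) = 0. Antisymmetry of T then gives T = 0,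
that is, W = 1/2 almost everywhere. -/

theorem integral_exp_mul_sin (n : ℤ) :
    ∫ x in (0 : ℝ)..Real.pi, Complex.exp (-(2 * n * x) * Complex.I) * Real.sin x
      = -2 / (4 * (n : ℂ) ^ 2 - 1) := by
  have hc : (4 * (n : ℂ) ^ 2 - 1) ≠ 0 := by
    have h : (4 * n ^ 2 - 1 : ℤ) ≠ 0 := by omega
    exact_mod_cast h
  have hd : ∀ x ∈ Set.uIcc (0 : ℝ) Real.pi, HasDerivAt
      (fun x : ℝ => Complex.exp (-(2 * n * x) * Complex.I) *
        (Complex.cos x + 2 * Complex.I * n * Complex.sin x) / (4 * (n : ℂ) ^ 2 - 1))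
      (Complex.exp (-(2 * n * x) * Complex.I) * Real.sin x) x := by
    intro x _
    have h1 : HasDerivAt (fun z : ℂ => Complex.exp (-(2 * n * z) * Complex.I))
        (Complex.exp (-(2 * n * (x : ℂ)) * Complex.I) * (-(2 * n * 1) * Complex.I)) (x : ℂ) :=
      ((((hasDerivAt_id (x : ℂ)).const_mul (2 * (n : ℂ))).neg).mul_const Complex.I).cexp
    have h2 : HasDerivAt (fun z : ℂ => Complex.cos z + 2 * Complex.I * n * Complex.sin z)
        (-Complex.sin x + 2 * Complex.I * n * Complex.cos x) (x : ℂ) :=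
      (Complex.hasDerivAt_cos _).add ((Complex.hasDerivAt_sin _).const_mul _)
    have h3 := ((h1.mul h2).div_const (4 * (n : ℂ) ^ 2 - 1)).comp_ofReal
    refine h3.congr_deriv ?_
    rw [Complex.ofReal_sin, div_eq_iff hc]
    linear_combination (Complex.exp (-(2 * n * (x : ℂ)) * Complex.I)) *
      (-4 * (n : ℂ) ^ 2 * Complex.sin x) * Complex.I_mul_I
  rw [intervalIntegral.integral_eq_sub_of_hasDerivAt hd
    (Continuous.intervalIntegrable (by fun_prop) _ _)]
  have he : Complex.exp (-(2 * n * (Real.pi : ℂ)) * Complex.I) = 1 := by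
    rw [Complex.exp_eq_one_iff]
    exact ⟨-n, by push_cast; ring⟩
  simp only [he, Complex.ofReal_zero]
  simp
  ring

/-- The function has period π, so its frequencies are 2n; the coefficients decay like 1/n², which
gives pointwise convergence. What matters later is that only the coefficient at n = 0 is positive.
-/
theorem hasSum_abs_sin (t : ℝ) :
    HasSum (fun n : ℤ => ((-(2 / Real.pi) / (4 * (n : ℝ) ^ 2 - 1) : ℝ) : ℂ) *
      Complex.exp (2 * n * t * Complex.I)) (|Real.sin t| : ℝ) := by
  have : Fact (0 < Real.pi) := ⟨Real.pi_pos⟩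
  have hper : Function.Periodic (fun x : ℝ => ((|Real.sin x| : ℝ) : ℂ)) Real.pi := fun x => by
    simp [Real.sin_add_pi]
  let f : C(AddCircle Real.pi, ℂ) :=
    ⟨hper.lift, continuous_coinduced_dom.mpr (by
      change Continuous (fun x : ℝ => ((|Real.sin x| : ℝ) : ℂ))
      fun_prop)⟩
  have hf : ∀ x : ℝ, f (x : AddCircle Real.pi) = ((|Real.sin x| : ℝ) : ℂ) := fun x => rfl
  have hcoef : ∀ n : ℤ, fourierCoeff f n =
      ((-(2 / Real.pi) / (4 * (n : ℝ) ^ 2 - 1) : ℝ) : ℂ) := by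
    intro n
    rw [fourierCoeff_eq_intervalIntegral f n 0, zero_add]
    have : ∫ x in (0 : ℝ)..Real.pi, fourier (-n) (x : AddCircle Real.pi) • f x
        = ∫ x in (0 : ℝ)..Real.pi,
          Complex.exp (-(2 * n * x) * Complex.I) * Real.sin x := by
      refine intervalIntegral.integral_congr fun x hx => ?_
      rw [Set.uIcc_of_le Real.pi_pos.le] at hx
      simp only [hf, smul_eq_mul]
      rw [abs_of_nonneg (Real.sin_nonneg_of_nonneg_of_le_pi hx.1 hx.2), fourier_coe_apply]
      congr 2
      have : (Real.pi : ℂ) ≠ 0 := by exact_mod_cast Real.pi_ne_zero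
      field_simp
      push_cast
      ring
    rw [this, integral_exp_mul_sin]
    push_cast
    simp only [Complex.real_smul]
    push_cast
    ring
  have hsum : Summable (fourierCoeff f) := by
    have h1 : Summable fun n : ℤ => 1 / (n : ℝ) ^ 2 :=
      Real.summable_one_div_int_pow.mpr one_lt_two
    refine Summable.of_norm_bounded_eventually (g := fun n : ℤ => 1 / (n : ℝ) ^ 2) h1 ?_
    filter_upwards [Filter.eventually_cofinite_ne (0 : ℤ)] with n hn
    rw [hcoef, Complex.norm_real, Real.norm_eq_abs, abs_div, abs_neg,
      abs_of_pos (div_pos two_pos Real.pi_pos)]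
    have hn1 : (1 : ℝ) ≤ (n : ℝ) ^ 2 := by
      have : (1 : ℤ) ≤ n ^ 2 := by
        have := sq_pos_of_ne_zero hn
        omega
      exact_mod_cast this
    rw [abs_of_pos (by linarith)]
    have hp : 2 / Real.pi ≤ 1 := by
      rw [div_le_one Real.pi_pos]; linarith [Real.pi_gt_three]
    exact div_le_div₀ zero_le_one hp (by linarith) (by linarith)
  have h := has_pointwise_sum_fourier_series_of_summable hsum (t : AddCircle Real.pi)
  rw [hf] at h
  refine h.congr_fun fun n => ?_
  rw [hcoef, smul_eq_mul, fourier_coe_apply]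
  congr 2
  have : (Real.pi : ℂ) ≠ 0 := by exact_mod_cast Real.pi_ne_zero
  field_simp

/-! ### The norm of an antisymmetric kernel -/

theorem integrable_of_measurable_of_abs_le {Ω : Type*} [MeasurableSpace Ω] {μ : Measure Ω}
    [IsFiniteMeasure μ] {f : Ω → ℝ} (hf : Measurable f) {B : ℝ} (hB : ∀ x, |f x| ≤ B) :
    Integrable f μ :=
  Integrable.of_bound hf.aestronglyMeasurable B (ae_of_all _ hB)

theorem sq_integral_le {Ω : Type*} [MeasurableSpace Ω] (μ : Measure Ω) [IsProbabilityMeasure μ]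
    {f : Ω → ℝ} (hf : Measurable f) {B : ℝ} (hB : ∀ x, |f x| ≤ B) :
    (∫ x, f x ∂μ) ^ 2 ≤ ∫ x, f x ^ 2 ∂μ := by
  have h := ProbabilityTheory.variance_nonneg f μ
  rw [ProbabilityTheory.variance_eq_sub
    (MemLp.of_bound hf.aestronglyMeasurable B (ae_of_all _ hB))] at h
  simpa using h

/-- Each Fourier mode of |sin(θ - θ')| factorises over the two variables, so it integrates to c_n |∫
r e^(2inθ)|². Since c_n < 0 for n ≠ 0, only the mode n = 0, with c_0 = 2/π, is kept. -/
theorem integral_mul_abs_sin_le {Ω : Type*} [MeasurableSpace Ω] (μ : Measure Ω)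
    [IsProbabilityMeasure μ] {r θ : Ω → ℝ} (hr : Measurable r) (hθ : Measurable θ) {B : ℝ}
    (hB : ∀ x, |r x| ≤ B) :
    ∫ p : Ω × Ω, r p.1 * r p.2 * |Real.sin (θ p.1 - θ p.2)| ∂(μ.prod μ)
      ≤ 2 / Real.pi * (∫ x, r x ∂μ) ^ 2 := by
  have hB0 : ∀ x, 0 ≤ B := fun x => (abs_nonneg _).trans (hB x)
  let c : ℤ → ℝ := fun n => -(2 / Real.pi) / (4 * (n : ℝ) ^ 2 - 1)
  let F : ℤ → Ω × Ω → ℂ := fun n p =>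
    ((r p.1 * r p.2 : ℝ) : ℂ) * ((c n : ℂ) * Complex.exp (2 * n * (θ p.1 - θ p.2) * Complex.I))
  have hexp : ∀ (n : ℤ) (s : ℝ), ‖Complex.exp (2 * n * s * Complex.I)‖ = 1 := fun n s => by
    have := Complex.norm_exp_ofReal_mul_I (2 * n * s)
    push_cast at this
    exact this
  have hFn : ∀ n p, ‖F n p‖ = |r p.1| * |r p.2| * |c n| := fun n p => by
    have := hexp n (θ p.1 - θ p.2)
    push_cast at this
    simp only [F, norm_mul, this, Complex.norm_real, Real.norm_eq_abs, mul_one]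
  have hFm : ∀ n, Measurable (F n) := fun n => by
    simp only [F]
    fun_prop
  have hFi : ∀ n, Integrable (F n) (μ.prod μ) := fun n =>
    Integrable.of_bound (hFm n).aestronglyMeasurable (B * B * |c n|) (ae_of_all _ fun p => by
      rw [hFn]
      have := hB p.1
      have := hB p.2
      have := hB0 p.1
      gcongr)
  have hFs : ∀ p : Ω × Ω, HasSum (fun n => F n p)
      ((r p.1 * r p.2 * |Real.sin (θ p.1 - θ p.2)| : ℝ) : ℂ) := fun p => by
    have := (hasSum_abs_sin (θ p.1 - θ p.2)).mul_left ((r p.1 * r p.2 : ℝ) : ℂ)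
    push_cast at this ⊢
    simpa only [F, c, Complex.ofReal_mul, Complex.ofReal_div, Complex.ofReal_neg,
      Complex.ofReal_sub, Complex.ofReal_pow, Complex.ofReal_ofNat, Complex.ofReal_one,
      Complex.ofReal_intCast] using this
  have hcs : Summable fun n => |c n| := by
    have := (hasSum_abs_sin 0).summable.norm
    simpa only [norm_mul, Complex.norm_real, Complex.ofReal_zero, mul_zero, zero_mul,
      Complex.exp_zero, norm_one, mul_one, Real.norm_eq_abs] using this
  have hint : HasSum (fun n => ∫ p, F n p ∂(μ.prod μ))
      ((∫ p : Ω × Ω, r p.1 * r p.2 * |Real.sin (θ p.1 - θ p.2)| ∂(μ.prod μ) : ℝ) : ℂ) := by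
    have h := hasSum_integral_of_summable_integral_norm hFi (by
      simp_rw [hFn, integral_mul_const]
      exact hcs.mul_left _)
    rw [← integral_complex_ofReal]
    rwa [integral_congr_ae (ae_of_all _ fun p => (hFs p).tsum_eq)] at h
  have hval : ∀ n : ℤ, ∫ p, F n p ∂(μ.prod μ) =
      ((c n * ‖∫ x, (r x : ℂ) * Complex.exp (2 * n * θ x * Complex.I) ∂μ‖ ^ 2 : ℝ) : ℂ) := by
    intro n
    have h1 : ∀ p, F n p = (c n : ℂ) * (((r p.1 : ℂ) * Complex.exp (2 * n * θ p.1 * Complex.I)) *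
        (starRingEnd ℂ) ((r p.2 : ℂ) * Complex.exp (2 * n * θ p.2 * Complex.I))) := fun p => by
      simp only [F, map_mul, Complex.conj_ofReal, ← Complex.exp_conj, Complex.conj_I, map_ofNat,
        map_intCast]
      rw [show (2 * n * (θ p.1 - θ p.2) * Complex.I : ℂ) =
        2 * n * θ p.1 * Complex.I + 2 * n * θ p.2 * -Complex.I by ring, Complex.exp_add]
      push_cast
      ring
    simp_rw [h1]
    rw [integral_const_mul, integral_prod_mul
      (f := fun x => (r x : ℂ) * Complex.exp (2 * n * θ x * Complex.I))
      (g := fun x => (starRingEnd ℂ) ((r x : ℂ) * Complex.exp (2 * n * θ x * Complex.I))),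
      integral_conj, Complex.mul_conj, Complex.normSq_eq_norm_sq]
    push_cast
    rfl
  simp_rw [hval] at hint
  have hre := Complex.hasSum_ofReal.mp hint |>.neg
  -- In the negated series all terms with n ≠ 0 are nonnegative, so its term at 0 is a lower bound
  -- for the sum.
  have := sum_le_hasSum {0} (fun n hn => ?_) hre
  · rw [Finset.sum_singleton] at this
    simp only [c] at this
    have h0 : ∫ x, (r x : ℂ) * Complex.exp (2 * (0 : ℤ) * θ x * Complex.I) ∂μ =
        ((∫ x, r x ∂μ : ℝ) : ℂ) := by
      rw [← integral_complex_ofReal]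
      simp
    rw [h0, Complex.norm_real, Real.norm_eq_abs, sq_abs] at this
    norm_num at this
    linarith
  · have hn0 : n ≠ 0 := by simpa using hn
    have hn1 : (1 : ℝ) ≤ (n : ℝ) ^ 2 := by
      have : (1 : ℤ) ≤ n ^ 2 := sq_pos_of_ne_zero hn0
      exact_mod_cast this
    have : c n ≤ 0 := div_nonpos_of_nonpos_of_nonneg
      (neg_nonpos.mpr (div_pos two_pos Real.pi_pos).le) (by linarith)
    have := mul_nonpos_of_nonpos_of_nonneg this
      (sq_nonneg ‖∫ x, (r x : ℂ) * Complex.exp (2 * n * θ x * Complex.I) ∂μ‖)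
    linarith

/-- The integrand is the area of the parallelogram spanned by two values of the plane vector (g, h).
In polar coordinates it is r r' |sin(θ - θ')|, and (∫ r)² ≤ ∫ r² finishes. -/
theorem integral_abs_mul_sub_mul_le {Ω : Type*} [MeasurableSpace Ω] (μ : Measure Ω)
    [IsProbabilityMeasure μ] {g h : Ω → ℝ} (hg : Measurable g) (hh : Measurable h) {B : ℝ}
    (hgB : ∀ x, |g x| ≤ B) (hhB : ∀ x, |h x| ≤ B) :
    ∫ p : Ω × Ω, |g p.1 * h p.2 - g p.2 * h p.1| ∂(μ.prod μ)
      ≤ 2 / Real.pi * (∫ x, g x ^ 2 ∂μ + ∫ x, h x ^ 2 ∂μ) := by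
  let z : Ω → ℂ := fun x => ⟨g x, h x⟩
  have hz : Measurable z := Complex.measurableEquivRealProd.symm.measurable.comp (hg.prodMk hh)
  let r : Ω → ℝ := fun x => ‖z x‖
  let θ : Ω → ℝ := fun x => Complex.arg (z x)
  have hgr : ∀ x, g x = r x * Real.cos (θ x) := fun x => (Complex.norm_mul_cos_arg (z x)).symm
  have hhr : ∀ x, h x = r x * Real.sin (θ x) := fun x => (Complex.norm_mul_sin_arg (z x)).symm
  have hrsq : ∀ x, r x ^ 2 = g x ^ 2 + h x ^ 2 := fun x => by
    rw [hgr, hhr]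
    linear_combination (-(r x) ^ 2) * Real.sin_sq_add_cos_sq (θ x)
  have hr0 : ∀ x, 0 ≤ r x := fun x => norm_nonneg _
  have hr : Measurable r := hz.norm
  have hrB : ∀ x, |r x| ≤ B + B := fun x => by
    rw [abs_of_nonneg (hr0 x)]
    exact (Complex.norm_le_abs_re_add_abs_im (z x)).trans (add_le_add (hgB x) (hhB x))
  have hgi : Integrable (fun x => g x ^ 2) μ :=
    integrable_of_measurable_of_abs_le (hg.pow_const 2) (B := B ^ 2) fun x => by
      rw [abs_pow]; exact pow_le_pow_left₀ (abs_nonneg _) (hgB x) 2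
  have hhi : Integrable (fun x => h x ^ 2) μ :=
    integrable_of_measurable_of_abs_le (hh.pow_const 2) (B := B ^ 2) fun x => by
      rw [abs_pow]; exact pow_le_pow_left₀ (abs_nonneg _) (hhB x) 2
  have key := integral_mul_abs_sin_le μ hr (Complex.measurable_arg.comp hz) hrB
  have heq : ∀ p : Ω × Ω, |g p.1 * h p.2 - g p.2 * h p.1| =
      r p.1 * r p.2 * |Real.sin (θ p.1 - θ p.2)| := fun p => by
    rw [← abs_of_nonneg (mul_nonneg (hr0 p.1) (hr0 p.2)), ← abs_mul, hgr p.1, hgr p.2, hhr p.1, hhr p.2,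
      Real.sin_sub, ← abs_neg]
    congr 1
    ring
  simp_rw [heq]
  refine key.trans (mul_le_mul_of_nonneg_left ?_ (div_pos two_pos Real.pi_pos).le)
  rw [← integral_add hgi hhi]
  simp_rw [← hrsq]
  exact sq_integral_le μ hr hrB

/-! ### Bounded measurable functions -/

/-- Bounded measurable real functions. -/
def IsBoundedMeasurable {α : Type*} [MeasurableSpace α] (f : α → ℝ) : Prop :=
  Measurable f ∧ ∃ B : ℝ, ∀ x, |f x| ≤ B

namespace IsBoundedMeasurable

variable {α β : Type*} [MeasurableSpace α] [MeasurableSpace β] {f g : α → ℝ}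

theorem integrable (hf : IsBoundedMeasurable f) (μ : Measure α) [IsFiniteMeasure μ] :
    Integrable f μ :=
  let ⟨_, hB⟩ := hf.2
  integrable_of_measurable_of_abs_le hf.1 hB

theorem const (c : ℝ) : IsBoundedMeasurable fun _ : α => c :=
  ⟨measurable_const, |c|, fun _ => le_rfl⟩

theorem mul (hf : IsBoundedMeasurable f) (hg : IsBoundedMeasurable g) :
    IsBoundedMeasurable fun x => f x * g x := by
  obtain ⟨hf, B, hB⟩ := hf
  obtain ⟨hg, D, hD⟩ := hg
  refine ⟨hf.mul hg, B * D, fun x => ?_⟩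
  rw [abs_mul]
  exact mul_le_mul (hB x) (hD x) (abs_nonneg _) ((abs_nonneg _).trans (hB x))

theorem add (hf : IsBoundedMeasurable f) (hg : IsBoundedMeasurable g) :
    IsBoundedMeasurable fun x => f x + g x := by
  obtain ⟨hf, B, hB⟩ := hf
  obtain ⟨hg, D, hD⟩ := hg
  exact ⟨hf.add hg, B + D, fun x => (abs_add_le _ _).trans (add_le_add (hB x) (hD x))⟩

theorem pow_two (hf : IsBoundedMeasurable f) : IsBoundedMeasurable fun x => f x ^ 2 := by
  simpa only [sq] using hf.mul hf

theorem prod {ι : Type*} (s : Finset ι) {f : ι → α → ℝ}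
    (hf : ∀ i ∈ s, IsBoundedMeasurable (f i)) :
    IsBoundedMeasurable fun x => ∏ i ∈ s, f i x := by
  classical
  induction s using Finset.induction_on with
  | empty => simpa using const 1
  | insert a s ha ih =>
    simp only [Finset.prod_insert ha]
    exact (hf a (Finset.mem_insert_self a s)).mul
      (ih fun i hi => hf i (Finset.mem_insert_of_mem hi))

theorem comp (hf : IsBoundedMeasurable f) {φ : β → α} (hφ : Measurable φ) :
    IsBoundedMeasurable fun x => f (φ x) :=
  ⟨hf.1.comp hφ, hf.2.imp fun _ hB x => hB (φ x)⟩

theorem integral_right {μ : Measure β} [IsProbabilityMeasure μ] {f : α → β → ℝ}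
    (hf : IsBoundedMeasurable fun p : α × β => f p.1 p.2) :
    IsBoundedMeasurable fun x => ∫ y, f x y ∂μ := by
  obtain ⟨hm, B, hB⟩ := hf
  refine ⟨(hm.stronglyMeasurable.integral_prod_right (ν := μ)).measurable, B, fun x => ?_⟩
  have := norm_integral_le_of_norm_le_const (μ := μ) (f := f x) (C := B)
    (ae_of_all _ fun y => hB (x, y))
  simpa using this

theorem integral_comm {μ : Measure α} {ν : Measure β} [IsProbabilityMeasure μ]
    [IsProbabilityMeasure ν] {f : α → β → ℝ}
    (hf : IsBoundedMeasurable fun p : α × β => f p.1 p.2) :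
    ∫ x, ∫ y, f x y ∂ν ∂μ = ∫ y, ∫ x, f x y ∂μ ∂ν :=
  integral_integral_swap (hf.integrable _)

end IsBoundedMeasurable

theorem IsKernel.isBoundedMeasurable {U : I → I → ℝ} (hU : IsKernel U) :
    IsBoundedMeasurable fun p : I × I => U p.1 p.2 :=
  ⟨hU.measurable, hU.bounded.imp fun _ hB p => hB p.1 p.2⟩

theorem IsKernel.comp {α : Type*} [MeasurableSpace α] {U : I → I → ℝ} (hU : IsKernel U)
    {a b : α → I} (ha : Measurable a) (hb : Measurable b) :
    IsBoundedMeasurable fun x => U (a x) (b x) :=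
  hU.isBoundedMeasurable.comp (ha.prodMk hb)

/-! ### The integral operator of an antisymmetric kernel -/

/-- The integral operator of the kernel `U`. -/
noncomputable def kernelOp (U : I → I → ℝ) (v : I → ℝ) (x : I) : ℝ := ∫ y, U x y * v y

section kernelOp

variable {U : I → I → ℝ} (hU : IsKernel U) (hanti : ∀ x y, U x y = -U y x)
include hU

theorem IsKernel.isBoundedMeasurable_kernelOp {v : I → ℝ} (hv : IsBoundedMeasurable v) :
    IsBoundedMeasurable (kernelOp U v) :=
  (hU.isBoundedMeasurable.mul (hv.comp measurable_snd)).integral_right (f := fun x y => U x y * v y)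

theorem IsKernel.isBoundedMeasurable_iterate {v : I → ℝ} (hv : IsBoundedMeasurable v) (n : ℕ) :
    IsBoundedMeasurable ((kernelOp U)^[n] v) := by
  induction n with
  | zero => simpa using hv
  | succ n ih =>
    rw [Function.iterate_succ_apply']
    exact hU.isBoundedMeasurable_kernelOp ih

include hanti

theorem integral_mul_kernelOp {f g : I → ℝ} (hf : IsBoundedMeasurable f)
    (hg : IsBoundedMeasurable g) :
    ∫ x, f x * kernelOp U g x = -∫ x, kernelOp U f x * g x := by
  simp only [kernelOp, ← integral_const_mul, ← integral_mul_const, ← integral_neg]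
  rw [IsBoundedMeasurable.integral_comm
    ((hf.comp measurable_fst).mul (hU.isBoundedMeasurable.mul (hg.comp measurable_snd)))]
  refine integral_congr_ae (ae_of_all _ fun x => integral_congr_ae (ae_of_all _ fun y => ?_))
  simp only
  rw [hanti x y]
  ring

theorem integral_kernelOp_sq_eq {v : I → ℝ} (hv : IsBoundedMeasurable v) :
    ∫ x, kernelOp U v x ^ 2 = -∫ x, v x * kernelOp U (kernelOp U v) x := by
  rw [integral_mul_kernelOp hU hanti hv (hU.isBoundedMeasurable_kernelOp hv), neg_neg]
  simp only [sq]

/-- By antisymmetry, 2⟨g, Tv⟩ is the integral of U against g(x)v(y) - g(y)v(x), hence at most half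
the L¹ norm of that function, which `integral_abs_mul_sub_mul_le` bounds. -/
theorem integral_kernelOp_sq_le (hhalf : ∀ x y, |U x y| ≤ 1 / 2) {v : I → ℝ}
    (hv : IsBoundedMeasurable v) :
    ∫ x, kernelOp U v x ^ 2 ≤ (∫ x, v x ^ 2) / Real.pi ^ 2 := by
  have hpi := Real.pi_pos
  have hTv := hU.isBoundedMeasurable_kernelOp hv
  -- The factor π is the optimal scaling: with A = ‖Tv‖² and B = ‖v‖² the estimate reads 2πA ≤ πA +
  -- B/π.
  let g : I → ℝ := fun x => Real.pi * kernelOp U v x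
  have hg : IsBoundedMeasurable g := (IsBoundedMeasurable.const Real.pi).mul hTv
  have hm1 : IsBoundedMeasurable fun p : I × I => U p.1 p.2 * (g p.1 * v p.2) :=
    hU.isBoundedMeasurable.mul ((hg.comp measurable_fst).mul (hv.comp measurable_snd))
  have hm2 : IsBoundedMeasurable fun p : I × I => U p.1 p.2 * (g p.2 * v p.1) :=
    hU.isBoundedMeasurable.mul ((hg.comp measurable_snd).mul (hv.comp measurable_fst))
  have e1 : ∫ p : I × I, U p.1 p.2 * (g p.1 * v p.2) = Real.pi * ∫ x, kernelOp U v x ^ 2 := by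
    rw [Measure.volume_eq_prod, integral_prod _ (hm1.integrable _), ← integral_const_mul]
    refine integral_congr_ae (ae_of_all _ fun x => ?_)
    have : ∀ y, U x y * (g x * v y) = g x * (U x y * v y) := fun y => by ring
    simp only [this, integral_const_mul, g]
    change _ * kernelOp U v x = _
    ring
  have e2 : ∫ p : I × I, U p.1 p.2 * (g p.2 * v p.1) = -(Real.pi * ∫ x, kernelOp U v x ^ 2) := by
    rw [← e1, Measure.volume_eq_prod, ← integral_prod_swap, ← integral_neg]
    refine integral_congr_ae (ae_of_all _ fun p => ?_)
    simp only [Prod.fst_swap, Prod.snd_swap]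
    rw [hanti]
    ring
  obtain ⟨B, hB⟩ := hg.2
  obtain ⟨D, hD⟩ := hv.2
  have key := integral_abs_mul_sub_mul_le (volume : Measure I) hg.1 hv.1
    (fun x => (hB x).trans (le_max_left B D)) (fun x => (hD x).trans (le_max_right B D))
  have hle : ∫ p : I × I, (U p.1 p.2 * (g p.1 * v p.2) - U p.1 p.2 * (g p.2 * v p.1)) ≤
      ∫ p : I × I, 1 / 2 * |g p.1 * v p.2 - g p.2 * v p.1| := by
    have hm3 : IsBoundedMeasurable fun p : I × I => 1 / 2 * |g p.1 * v p.2 - g p.2 * v p.1| := by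
      have h1 := (hg.comp (β := I × I) measurable_fst).mul (hv.comp measurable_snd)
      have h2 := (hg.comp (β := I × I) measurable_snd).mul (hv.comp measurable_fst)
      refine ⟨((h1.1.sub h2.1).abs).const_mul _, ?_⟩
      obtain ⟨B₁, hB₁⟩ := h1.2
      obtain ⟨B₂, hB₂⟩ := h2.2
      refine ⟨1 / 2 * (B₁ + B₂), fun p => ?_⟩
      rw [abs_mul, abs_abs, abs_of_pos (by norm_num : (0 : ℝ) < 1 / 2)]
      exact mul_le_mul_of_nonneg_left ((abs_sub _ _).trans (add_le_add (hB₁ p) (hB₂ p)))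
        (by norm_num)
    refine integral_mono ((hm1.integrable _).sub (hm2.integrable _)) (hm3.integrable _) fun p => ?_
    simp only
    rw [← mul_sub]
    refine (le_abs_self _).trans ?_
    rw [abs_mul]
    exact mul_le_mul_of_nonneg_right (hhalf _ _) (abs_nonneg _)
  rw [integral_sub (hm1.integrable _) (hm2.integrable _), e1, e2, integral_const_mul] at hle
  have hgg : ∫ x, g x ^ 2 = Real.pi ^ 2 * ∫ x, kernelOp U v x ^ 2 := by
    simp only [g, mul_pow, integral_const_mul]
  rw [hgg] at key
  rw [Measure.volume_eq_prod] at hle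
  rw [le_div_iff₀ (by positivity)]
  have h3 : 2 * Real.pi * ∫ x, kernelOp U v x ^ 2 ≤
      1 / Real.pi * ((Real.pi ^ 2 * ∫ x, kernelOp U v x ^ 2) + ∫ x, v x ^ 2) := by
    have h4 := hle.trans (mul_le_mul_of_nonneg_left key (by norm_num : (0 : ℝ) ≤ 1 / 2))
    calc _ = _ := by ring
      _ ≤ _ := h4
      _ = _ := by ring
  rw [one_div_mul_eq_div, le_div_iff₀ hpi] at h3
  linarith

/-- The square of the norm of the `n`-th iterate of the constant function `1`. -/
noncomputable def iterateNormSq (U : I → I → ℝ) (n : ℕ) : ℝ :=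
  ∫ x, ((kernelOp U)^[n] (fun _ => 1)) x ^ 2

omit hU hanti in
theorem iterateNormSq_nonneg (n : ℕ) : 0 ≤ iterateNormSq U n :=
  integral_nonneg fun _ => sq_nonneg _

theorem iterateNormSq_add_le (hhalf : ∀ x y, |U x y| ≤ 1 / 2) (n j : ℕ) :
    iterateNormSq U (n + j) ≤ iterateNormSq U n / Real.pi ^ (2 * j) := by
  have hpi := Real.pi_pos
  induction j with
  | zero => simp
  | succ j ih =>
    have h := integral_kernelOp_sq_le hU hanti hhalf
      (hU.isBoundedMeasurable_iterate (IsBoundedMeasurable.const 1) (n + j))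
    calc iterateNormSq U (n + (j + 1)) ≤ iterateNormSq U (n + j) / Real.pi ^ 2 := by
          simpa only [iterateNormSq, ← add_assoc, Function.iterate_succ_apply'] using h
      _ ≤ (iterateNormSq U n / Real.pi ^ (2 * j)) / Real.pi ^ 2 := by gcongr
      _ = _ := by rw [div_div, ← pow_add, mul_add, mul_one]

/-- Antisymmetry gives ‖T1‖² = -∫ T²1, to which Cauchy-Schwarz applies. -/
theorem iterateNormSq_one_sq_le : iterateNormSq U 1 ^ 2 ≤ iterateNormSq U 2 := by
  have h := integral_kernelOp_sq_eq hU hanti (IsBoundedMeasurable.const (α := I) 1)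
  have hb := hU.isBoundedMeasurable_iterate (IsBoundedMeasurable.const (α := I) 1) 2
  obtain ⟨B, hB⟩ := hb.2
  have h2 := sq_integral_le (volume : Measure I) hb.1 hB
  simp only [one_mul] at h
  have h1 : iterateNormSq U 1 = -∫ x, ((kernelOp U)^[2] (fun _ => 1)) x := h
  rw [h1, neg_sq]
  exact h2

/-- For a, b, c in [-1/2, 1/2], the sum (1/2+a)(1/2+b)(1/2+c) + (1/2-a)(1/2-b)(1/2-c) = 1/4 + ab +
bc + ca is nonnegative. Take for a, b, c the values of U around a triangle and integrate: each of
the three products contributes -‖T1‖², so 3‖T1‖² ≤ 1/4. -/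
theorem iterateNormSq_one_le (hhalf : ∀ x y, |U x y| ≤ 1 / 2) : iterateNormSq U 1 ≤ 1 / 12 := by
  let d : I → ℝ := kernelOp U (fun _ => 1)
  have hd : IsBoundedMeasurable d := hU.isBoundedMeasurable_kernelOp (.const 1)
  have hdx : ∀ x, d x = ∫ y, U x y := fun x => by simp [d, kernelOp]
  have hpt : ∀ x, d x ^ 2 - 2 * kernelOp U d x ≤ 1 / 4 := by
    intro x
    have h1 : IsBoundedMeasurable fun p : I × I => U x p.1 * U x p.2 :=
      (hU.comp measurable_const measurable_fst).mul (hU.comp measurable_const measurable_snd)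
    have h2 : IsBoundedMeasurable fun p : I × I => U p.1 p.2 * U p.1 x :=
      (hU.comp measurable_fst measurable_snd).mul (hU.comp measurable_fst measurable_const)
    have h3 : IsBoundedMeasurable fun p : I × I => U p.2 p.1 * U p.2 x :=
      h2.comp measurable_swap
    have e1 : ∫ p : I × I, U x p.1 * U x p.2 = d x ^ 2 := by
      rw [Measure.volume_eq_prod, integral_prod_mul, hdx, sq]
    have e2 : ∫ p : I × I, U p.1 p.2 * U p.1 x = -kernelOp U d x := by
      rw [Measure.volume_eq_prod, integral_prod _ (h2.integrable _), kernelOp, ← integral_neg]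
      refine integral_congr_ae (ae_of_all _ fun y => ?_)
      simp only [integral_mul_const]
      rw [hanti x y, hdx]
      ring
    have e3 : ∫ p : I × I, U p.2 p.1 * U p.2 x = -kernelOp U d x := by
      rw [← e2, Measure.volume_eq_prod, ← integral_prod_swap]
      rfl
    have hle : ∫ p : I × I, (U x p.1 * U x p.2 + U p.1 p.2 * U p.1 x + U p.2 p.1 * U p.2 x) ≤
        ∫ _ : I × I, (1 / 4 : ℝ) := by
      refine integral_mono (((h1.integrable _).add (h2.integrable _)).add (h3.integrable _))
        (integrable_const _) fun p => ?_
      simp only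
      rw [hanti p.2 p.1, hanti p.1 x]
      have ha := abs_le.mp (hhalf x p.1)
      have hb := abs_le.mp (hhalf p.1 p.2)
      have hc := abs_le.mp (hhalf p.2 x)
      rw [hanti x p.2]
      generalize U x p.1 = a at *
      generalize U p.1 p.2 = b at *
      generalize U p.2 x = c at *
      nlinarith [mul_nonneg (mul_nonneg (sub_nonneg.mpr ha.1) (sub_nonneg.mpr hb.1))
          (sub_nonneg.mpr hc.1), mul_nonneg (mul_nonneg (sub_nonneg.mpr ha.2) (sub_nonneg.mpr hb.2))
          (sub_nonneg.mpr hc.2)]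
    rw [integral_add ((h1.add h2).integrable _) (h3.integrable _),
      integral_add (h1.integrable _) (h2.integrable _), e1, e2, e3] at hle
    simp at hle
    linarith
  have hT := hU.isBoundedMeasurable_kernelOp hd
  have hle : ∫ x, (d x ^ 2 - 2 * kernelOp U d x) ≤ ∫ _ : I, (1 / 4 : ℝ) :=
    integral_mono ((hd.pow_two.integrable _).sub ((hT.integrable _).const_mul 2))
      (integrable_const _) hpt
  rw [integral_sub (hd.pow_two.integrable _) ((hT.integrable _).const_mul 2),
    integral_const_mul] at hle
  have h := integral_mul_kernelOp hU hanti (IsBoundedMeasurable.const (α := I) 1) hd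
  simp only [one_mul] at h
  have hs : ∫ x, kernelOp U (fun _ => 1) x * d x = ∫ x, d x ^ 2 := by
    simp only [sq]
    rfl
  rw [h, hs] at hle
  change ∫ x, d x ^ 2 ≤ _
  simp at hle
  linarith

end kernelOp

/-! ### Powers of a kernel and integrals over paths -/

/-- `kernelPow U n` is the kernel of the `(n + 1)`-st power of the operator of `U`. -/
noncomputable def kernelPow (U : I → I → ℝ) : ℕ → I → I → ℝ
  | 0, x, y => U x y
  | n + 1, x, y => ∫ z, U x z * kernelPow U n z y

section kernelPow

variable {U : I → I → ℝ} (hU : IsKernel U)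
include hU

theorem IsKernel.isBoundedMeasurable_kernelPow (n : ℕ) :
    IsBoundedMeasurable fun p : I × I => kernelPow U n p.1 p.2 := by
  induction n with
  | zero => exact hU.isBoundedMeasurable
  | succ n ih =>
    exact IsBoundedMeasurable.integral_right (f := fun (p : I × I) z =>
      U p.1 z * kernelPow U n z p.2)
      ((hU.comp (measurable_fst.comp measurable_fst) measurable_snd).mul
        (ih.comp (measurable_snd.prodMk (measurable_snd.comp measurable_fst))))

theorem IsKernel.kernelPow_comp {α : Type*} [MeasurableSpace α] (n : ℕ)
    {a b : α → I} (ha : Measurable a) (hb : Measurable b) :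
    IsBoundedMeasurable fun x => kernelPow U n (a x) (b x) :=
  (hU.isBoundedMeasurable_kernelPow n).comp (ha.prodMk hb)

theorem kernelPow_succ' (n : ℕ) (x y : I) :
    kernelPow U (n + 1) x y = ∫ z, kernelPow U n x z * U z y := by
  induction n generalizing x y with
  | zero => rfl
  | succ n ih =>
    have h : ∀ z, kernelPow U (n + 1) z y = ∫ w, kernelPow U n z w * U w y := fun z => ih z y
    rw [kernelPow]
    simp_rw [h, ← integral_const_mul]
    rw [IsBoundedMeasurable.integral_comm]
    · refine integral_congr_ae (ae_of_all _ fun z => ?_)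
      simp only [kernelPow, ← integral_mul_const, mul_assoc]
    · exact (hU.comp measurable_const measurable_fst).mul
        ((hU.kernelPow_comp n measurable_fst measurable_snd).mul
          (hU.comp measurable_snd measurable_const))

theorem integral_kernelPow_mul (n : ℕ) {v : I → ℝ} (hv : IsBoundedMeasurable v) (x : I) :
    ∫ y, kernelPow U n x y * v y = (kernelOp U)^[n + 1] v x := by
  induction n generalizing x with
  | zero => rfl
  | succ n ih =>
    rw [Function.iterate_succ_apply', kernelOp]
    simp_rw [← ih, kernelPow, ← integral_const_mul, ← integral_mul_const, ← mul_assoc]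
    rw [IsBoundedMeasurable.integral_comm]
    exact ((hU.comp measurable_const measurable_snd).mul
      (hU.kernelPow_comp n measurable_snd measurable_fst)).mul (hv.comp measurable_fst)

theorem kernelPow_swap (hanti : ∀ x y, U x y = -U y x) (n : ℕ) (x y : I) :
    kernelPow U n y x = (-1) ^ (n + 1) * kernelPow U n x y := by
  induction n generalizing x y with
  | zero => simp [kernelPow, hanti y x]
  | succ n ih =>
    rw [kernelPow, kernelPow_succ' hU, ← integral_const_mul]
    refine integral_congr_ae (ae_of_all _ fun z => ?_)
    simp only
    rw [ih x z, hanti y z]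
    ring

/-- Cyclicity of the trace: one factor U moves from the front of the first power to the end of the
second. -/
theorem integral_kernelPow_mul_kernelPow_succ (a b : ℕ) :
    ∫ x, ∫ y, kernelPow U (a + 1) x y * kernelPow U b y x =
      ∫ x, ∫ y, kernelPow U a x y * kernelPow U (b + 1) y x := by
  have h1 : IsBoundedMeasurable fun p : (I × I) × I =>
      U p.1.1 p.2 * kernelPow U a p.2 p.1.2 * kernelPow U b p.1.2 p.1.1 :=
    ((hU.comp (by fun_prop) (by fun_prop)).mul (hU.kernelPow_comp a (by fun_prop) (by fun_prop))).mul
      (hU.kernelPow_comp b (by fun_prop) (by fun_prop))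
  calc _ = ∫ x, ∫ y, ∫ z, U x z * kernelPow U a z y * kernelPow U b y x := by
        simp_rw [kernelPow, integral_mul_const]
    _ = ∫ x, ∫ z, ∫ y, U x z * kernelPow U a z y * kernelPow U b y x :=
        integral_congr_ae (ae_of_all _ fun x => IsBoundedMeasurable.integral_comm
          (h1.comp (φ := fun p : I × I => ((x, p.1), p.2)) (by fun_prop)))
    _ = ∫ z, ∫ x, ∫ y, U x z * kernelPow U a z y * kernelPow U b y x :=
        IsBoundedMeasurable.integral_comm (IsBoundedMeasurable.integral_right
          (f := fun (p : I × I) y => U p.1 p.2 * kernelPow U a p.2 y * kernelPow U b y p.1)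
          (h1.comp (φ := fun p : (I × I) × I => ((p.1.1, p.2), p.1.2)) (by fun_prop)))
    _ = ∫ z, ∫ y, ∫ x, U x z * kernelPow U a z y * kernelPow U b y x :=
        integral_congr_ae (ae_of_all _ fun z => IsBoundedMeasurable.integral_comm
          (h1.comp (φ := fun p : I × I => ((p.1, p.2), z)) (by fun_prop)))
    _ = _ := by
        refine integral_congr_ae (ae_of_all _ fun z => integral_congr_ae (ae_of_all _ fun y => ?_))
        simp only [kernelPow_succ' hU b, ← integral_const_mul]
        refine integral_congr_ae (ae_of_all _ fun x => ?_)
        simp only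
        ring

theorem integral_kernelPow_mul_kernelPow_zero (a b : ℕ) :
    ∫ x, ∫ y, kernelPow U (a + b) x y * kernelPow U 0 y x =
      ∫ x, ∫ y, kernelPow U a x y * kernelPow U b y x := by
  suffices h : ∀ c, ∫ x, ∫ y, kernelPow U (a + b) x y * kernelPow U c y x =
      ∫ x, ∫ y, kernelPow U a x y * kernelPow U (b + c) y x from by simpa using h 0
  induction b with
  | zero => simp
  | succ b ih =>
    intro c
    rw [← add_assoc, integral_kernelPow_mul_kernelPow_succ hU, ih]
    simp only [add_assoc, add_comm 1 c]

theorem isBoundedMeasurable_prod_path {N : ℕ} :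
    IsBoundedMeasurable fun x : Fin (N + 1) → I => ∏ i : Fin N, U (x i.castSucc) (x i.succ) :=
  IsBoundedMeasurable.prod _ fun i _ => hU.comp (by fun_prop) (by fun_prop)

/-- The weight G on the two ends lets the induction absorb the first edge into it. Taking G = 1
gives paths, and G(x,y) = U(y,x) closes the path to a cycle. -/
theorem integral_prod_path_mul (N : ℕ) {G : I → I → ℝ}
    (hG : IsBoundedMeasurable fun p : I × I => G p.1 p.2) :
    ∫ x : Fin (N + 2) → I, (∏ i : Fin (N + 1), U (x i.castSucc) (x i.succ)) *
      G (x 0) (x (Fin.last _)) = ∫ x, ∫ y, kernelPow U N x y * G x y := by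
  induction N generalizing G with
  | zero =>
    have h := (volume_preserving_finTwoArrow I).symm.integral_comp'
      (g := fun x : Fin 2 → I => U (x 0) (x 1) * G (x 0) (x 1))
    refine Eq.trans (integral_congr_ae (ae_of_all _ fun x => ?_)) (h.symm.trans ?_)
    · simp
    rw [Measure.volume_eq_prod, integral_prod]
    · rfl
    · exact (hU.isBoundedMeasurable.mul hG).integrable _
  | succ N ih =>
    have h := (volume_preserving_piFinSuccAbove (fun _ : Fin (N + 3) => I) 0).symm.integral_comp'
      (g := fun x : Fin (N + 3) → I =>
        (∏ i : Fin (N + 2), U (x i.castSucc) (x i.succ)) * G (x 0) (x (Fin.last _)))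
    rw [← h]
    have hGG : IsBoundedMeasurable fun p : (I × I) × I => U p.2 p.1.1 * G p.2 p.1.2 :=
      (hU.comp (by fun_prop) (by fun_prop)).mul
        (hG.comp (φ := fun p : (I × I) × I => (p.2, p.1.2)) (by fun_prop))
    have hG' : IsBoundedMeasurable fun p : I × I => ∫ z, U z p.1 * G z p.2 :=
      IsBoundedMeasurable.integral_right (f := fun (p : I × I) z => U z p.1 * G z p.2) hGG
    have hF : IsBoundedMeasurable fun p : I × (Fin (N + 2) → I) =>
        (∏ i : Fin (N + 1), U (p.2 i.castSucc) (p.2 i.succ)) *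
          (U p.1 (p.2 0) * G p.1 (p.2 (Fin.last _))) :=
      ((isBoundedMeasurable_prod_path hU).comp measurable_snd).mul
        (hGG.comp (φ := fun p : I × (Fin (N + 2) → I) => ((p.2 0, p.2 (Fin.last _)), p.1))
          (by fun_prop))
    calc _ = ∫ p : I × (Fin (N + 2) → I),
          (∏ i : Fin (N + 1), U (p.2 i.castSucc) (p.2 i.succ)) *
          (U p.1 (p.2 0) * G p.1 (p.2 (Fin.last _))) := by
          refine integral_congr_ae (ae_of_all _ fun p => ?_)
          have h0 : ∀ p : I × (Fin (N + 2) → I), (MeasurableEquiv.piFinSuccAbove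
            (fun _ : Fin (N + 3) => I) 0).symm p = Fin.cons p.1 p.2 := fun p =>
              Fin.insertNth_zero' p.1 p.2
          simp only [h0]
          rw [Fin.prod_univ_succ]
          simp only [Fin.castSucc_zero, Fin.cons_zero, Fin.cons_succ, ← Fin.succ_castSucc,
            ← Fin.succ_last]
          ring
      _ = ∫ x : Fin (N + 2) → I, ∫ z : I,
          (∏ i : Fin (N + 1), U (x i.castSucc) (x i.succ)) *
          (U z (x 0) * G z (x (Fin.last _))) := by
          rw [Measure.volume_eq_prod, integral_prod_symm _ (hF.integrable _)]
      _ = ∫ x : Fin (N + 2) → I, (∏ i : Fin (N + 1), U (x i.castSucc) (x i.succ)) *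
          (∫ z : I, U z (x 0) * G z (x (Fin.last _))) := by
          simp_rw [integral_const_mul]
      _ = ∫ a, ∫ b, kernelPow U N a b * ∫ z, U z a * G z b :=
          ih (G := fun a b => ∫ z, U z a * G z b) hG'
      _ = ∫ a, ∫ b, ∫ z, U z a * kernelPow U N a b * G z b := by
          simp_rw [← integral_const_mul]
          refine integral_congr_ae (ae_of_all _ fun a => integral_congr_ae (ae_of_all _ fun b =>
            integral_congr_ae (ae_of_all _ fun z => ?_)))
          simp only
          ring
      _ = ∫ a, ∫ z, ∫ b, U z a * kernelPow U N a b * G z b :=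
          integral_congr_ae (ae_of_all _ fun a => IsBoundedMeasurable.integral_comm
            (((hU.comp (by fun_prop) (by fun_prop)).mul
              (hU.kernelPow_comp N (by fun_prop) (by fun_prop))).mul
              (hG.comp (φ := fun p : I × I => (p.2, p.1)) (by fun_prop))))
      _ = ∫ z, ∫ a, ∫ b, U z a * kernelPow U N a b * G z b :=
          IsBoundedMeasurable.integral_comm (IsBoundedMeasurable.integral_right
            (f := fun (p : I × I) b => U p.2 p.1 * kernelPow U N p.1 b * G p.2 b)
            (((hU.comp (by fun_prop) (by fun_prop)).mul
              (hU.kernelPow_comp N (by fun_prop) (by fun_prop))).mul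
              (hG.comp (φ := fun p : (I × I) × I => (p.1.2, p.2)) (by fun_prop))))
      _ = ∫ z, ∫ b, ∫ a, U z a * kernelPow U N a b * G z b :=
          integral_congr_ae (ae_of_all _ fun z => IsBoundedMeasurable.integral_comm
            (((hU.comp (by fun_prop) (by fun_prop)).mul
              (hU.kernelPow_comp N (by fun_prop) (by fun_prop))).mul
              (hG.comp (φ := fun p : I × I => (z, p.2)) (by fun_prop))))
      _ = _ := by
          simp_rw [kernelPow, integral_mul_const]

theorem integral_prod_path (N : ℕ) :
    ∫ x : Fin (N + 2) → I, ∏ i : Fin (N + 1), U (x i.castSucc) (x i.succ) =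
      ∫ x, (kernelOp U)^[N + 1] (fun _ => 1) x := by
  have h := integral_prod_path_mul hU N (G := fun _ _ => 1) (.const 1)
  simp only [mul_one] at h
  rw [h]
  refine integral_congr_ae (ae_of_all _ fun x => ?_)
  simp only [← integral_kernelPow_mul hU N (.const 1), mul_one]

variable (hanti : ∀ x y, U x y = -U y x)
include hanti

theorem integral_iterate_mul_iterate (a b : ℕ) {v w : I → ℝ} (hv : IsBoundedMeasurable v)
    (hw : IsBoundedMeasurable w) :
    ∫ x, v x * (kernelOp U)^[a + b] w x =
      (-1) ^ a * ∫ x, (kernelOp U)^[a] v x * (kernelOp U)^[b] w x := by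
  induction a generalizing v with
  | zero => simp
  | succ a ih =>
    rw [show a + 1 + b = (a + b) + 1 by ring, Function.iterate_succ_apply',
      integral_mul_kernelOp hU hanti hv (hU.isBoundedMeasurable_iterate hw _),
      ih (hU.isBoundedMeasurable_kernelOp hv), Function.iterate_succ_apply, pow_succ]
    ring

theorem integral_iterate_two_mul (n : ℕ) :
    ∫ x, (kernelOp U)^[2 * n] (fun _ => 1) x = (-1) ^ n * iterateNormSq U n := by
  have h := integral_iterate_mul_iterate hU hanti n n (IsBoundedMeasurable.const 1)
    (IsBoundedMeasurable.const 1)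
  simp only [one_mul, ← two_mul, ← sq] at h
  exact h

/-- Moving all n copies of T to the other side of the inner product shows that the integral equals
its own negative. -/
theorem integral_iterate_odd {n : ℕ} (hn : Odd n) :
    ∫ x, (kernelOp U)^[n] (fun _ => 1) x = 0 := by
  have h := integral_iterate_mul_iterate hU hanti n 0 (IsBoundedMeasurable.const 1)
    (IsBoundedMeasurable.const 1)
  simp only [one_mul, add_zero, Function.iterate_zero, id, mul_one, hn.neg_one_pow] at h
  linarith

/-- A closed walk with 2m + 2 steps is cut into two halves of m + 1 steps; transposing one of them
costs the sign (-1)^(m+1). -/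
theorem integral_cycle (m : ℕ) :
    ∫ x, ∫ y, kernelPow U (2 * m) x y * U y x =
      (-1) ^ (m + 1) * ∫ x, ∫ y, kernelPow U m x y ^ 2 := by
  have h := integral_kernelPow_mul_kernelPow_zero hU m m
  rw [← two_mul] at h
  refine h.trans ?_
  simp_rw [← integral_const_mul]
  refine integral_congr_ae (ae_of_all _ fun a => integral_congr_ae (ae_of_all _ fun b => ?_))
  simp only
  rw [kernelPow_swap hU hanti m a b]
  ring

/-- Since ‖Tf‖² = -⟨f, T²f⟩, the operators T² and T have the same kernel, so the exponent can be
lowered to 1. -/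
theorem kernelOp_ae_eq_zero_of_iterate {v : I → ℝ} (hv : IsBoundedMeasurable v) (m : ℕ)
    (h : (kernelOp U)^[m + 1] v =ᵐ[volume] 0) : kernelOp U v =ᵐ[volume] 0 := by
  induction m with
  | zero => exact h
  | succ m ih =>
    refine ih ?_
    have hb := hU.isBoundedMeasurable_iterate hv m
    have hs := integral_kernelOp_sq_eq hU hanti hb
    have h0 : ∫ x, (kernelOp U)^[m] v x * kernelOp U (kernelOp U ((kernelOp U)^[m] v)) x = 0 := by
      refine integral_eq_zero_of_ae ?_
      filter_upwards [h] with x hx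
      rw [Function.iterate_succ_apply', Function.iterate_succ_apply'] at hx
      simp [hx]
    rw [h0, neg_zero, integral_eq_zero_iff_of_nonneg (fun x => sq_nonneg _)
      ((hU.isBoundedMeasurable_kernelOp hb).pow_two.integrable _)] at hs
    filter_upwards [hs] with x hx
    rw [Function.iterate_succ_apply']
    simpa using hx

theorem kernelOp_ae_eq_zero_of_kernelPow (m : ℕ)
    (h : ∫ x, ∫ y, kernelPow U m x y ^ 2 = 0) {v : I → ℝ} (hv : IsBoundedMeasurable v) :
    kernelOp U v =ᵐ[volume] 0 := by
  refine kernelOp_ae_eq_zero_of_iterate hU hanti hv m ?_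
  have hb := (hU.isBoundedMeasurable_kernelPow m).pow_two
  rw [← integral_prod _ (hb.integrable _), integral_eq_zero_iff_of_nonneg
    (fun x => sq_nonneg _) (hb.integrable _)] at h
  filter_upwards [Measure.ae_ae_of_ae_prod h] with x hx
  rw [← integral_kernelPow_mul hU m hv]
  refine integral_eq_zero_of_ae ?_
  filter_upwards [hx] with y hy
  have : kernelPow U m x y = 0 := by simpa using hy
  simp [this]

end kernelPow

/-- Testing on indicator functions shows that W and 1/2 have the same integral over every rectangle.
Rectangles determine a finite measure on the square, and a measure determines its density almost
everywhere. -/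
theorem IsTournamenton.ae_eq_half {W : I → I → ℝ} (hW : IsTournamenton W)
    (h : ∀ v : I → ℝ, IsBoundedMeasurable v →
      kernelOp (fun x y => W x y - 1 / 2) v =ᵐ[volume] 0) :
    ∀ᵐ p : I × I, W p.1 p.2 = 1 / 2 := by
  have hWb := hW.toIsKernel.isBoundedMeasurable
  have hmW : Measurable fun p : I × I => ENNReal.ofReal (W p.1 p.2) := hWb.1.ennreal_ofReal
  have hrect : ∀ s t : Set I, MeasurableSet s → MeasurableSet t →
      ∫ p in s ×ˢ t, W p.1 p.2 = ∫ p : I × I in s ×ˢ t, (1 / 2 : ℝ) := by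
    intro s t hs ht
    rw [Measure.volume_eq_prod, setIntegral_prod _ (hWb.integrable _).integrableOn,
      setIntegral_prod _ (integrable_const _).integrableOn]
    refine integral_congr_ae ?_
    have hv := h (t.indicator fun _ => 1) ⟨measurable_const.indicator ht, 1, fun x => by
      by_cases hx : x ∈ t <;> simp [hx]⟩
    filter_upwards [ae_restrict_of_ae hv] with x hx
    have hx' : ∫ y in t, (W x y - 1 / 2) = 0 := by
      rw [← integral_indicator ht]
      refine Eq.trans ?_ hx
      rw [kernelOp]
      congr 1
      ext y
      by_cases hy : y ∈ t <;> simp [hy]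
    rw [integral_sub (((hWb.comp measurable_prodMk_left).integrable _).integrableOn)
      (integrable_const _).integrableOn] at hx'
    linarith
  have hmeas : (volume : Measure (I × I)).withDensity (fun p => ENNReal.ofReal (W p.1 p.2)) =
      (volume : Measure (I × I)).withDensity (fun _ => ENNReal.ofReal (1 / 2)) := by
    have := isFiniteMeasure_withDensity_ofReal (hWb.integrable volume).2
    refine Measure.ext_prod fun {s t} hs ht => ?_
    rw [withDensity_apply _ (hs.prod ht), withDensity_apply _ (hs.prod ht),
      ← ofReal_integral_eq_lintegral_ofReal (hWb.integrable _).integrableOn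
        (ae_of_all _ fun p => hW.nonneg _ _),
      ← ofReal_integral_eq_lintegral_ofReal (integrable_const _).integrableOn
        (ae_of_all _ fun p => by norm_num), hrect s t hs ht]
  rw [withDensity_eq_iff_of_sigmaFinite hmW.aemeasurable aemeasurable_const] at hmeas
  filter_upwards [hmeas] with p hp
  have := congrArg ENNReal.toReal hp
  rwa [ENNReal.toReal_ofReal (hW.nonneg _ _), ENNReal.toReal_ofReal (by norm_num)] at this

/-! ### Densities under reversals, padding and disjoint unions -/

namespace OrientedGraph

theorem mem_edgeFinset {V : Type*} [Fintype V] (H : OrientedGraph V) (e : V × V) :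
    e ∈ H.edgeFinset ↔ H.Adj e.1 e.2 := by
  simp [edgeFinset]

/-- Adjacency in the underlying simple graph. -/
def UAdj {V : Type*} (H : OrientedGraph V) (v w : V) : Prop := H.Adj v w ∨ H.Adj w v

section

variable {V V' : Type*} [Fintype V] [Fintype V'] {U : I → I → ℝ}

open scoped Classical in
/-- The edge `e` or its reversal, according to whether `e` is in `R`. -/
noncomputable def reverseEdge (R : Finset (V × V)) (e : V × V) : V × V :=
  if e ∈ R then e.swap else e

theorem injOn_reverseEdge (H : OrientedGraph V) (R : Finset (V × V)) :
    Set.InjOn (reverseEdge R) (H.edgeFinset : Set (V × V)) := by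
  rintro ⟨a, b⟩ he ⟨c, d⟩ he' h
  simp only [Finset.mem_coe, mem_edgeFinset] at he he'
  have h1 := H.asymm a b he
  unfold reverseEdge at h
  split_ifs at h <;> simp_all

open scoped Classical in
theorem edgeFinset_reverse (H : OrientedGraph V) (R : Finset (V × V)) :
    (H.reverse R).edgeFinset = H.edgeFinset.image (reverseEdge R) := by
  ext ⟨a, b⟩
  simp only [mem_edgeFinset, Finset.mem_image, Prod.exists, reverse, reverseEdge]
  constructor
  · rintro (⟨h1, h2⟩ | ⟨h1, h2⟩)
    · exact ⟨a, b, h1, by simp [h2]⟩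
    · exact ⟨b, a, h1, by simp [h2]⟩
  · rintro ⟨c, d, h1, h2⟩
    split_ifs at h2 with h3
    · obtain ⟨rfl, rfl⟩ := Prod.mk.inj h2
      exact Or.inr ⟨h1, h3⟩
    · obtain ⟨rfl, rfl⟩ := Prod.mk.inj h2
      exact Or.inl ⟨h1, h3⟩

open scoped Classical in
theorem edgeFinset_of_isPadding {H : OrientedGraph V'} {G : OrientedGraph V} {f : V' ↪ V}
    (hf : ∀ a b, G.Adj a b ↔ ∃ v w, f v = a ∧ f w = b ∧ H.Adj v w) :
    G.edgeFinset = H.edgeFinset.map (f.prodMap f) := by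
  ext ⟨a, b⟩
  simp only [mem_edgeFinset, Finset.mem_map, Prod.exists, hf, Function.Embedding.coe_prodMap,
    Prod.map_apply, Prod.mk.injEq]
  constructor
  · rintro ⟨v, w, h1, h2, h3⟩
    exact ⟨v, w, h3, h1, h2⟩
  · rintro ⟨v, w, h3, h1, h2⟩
    exact ⟨v, w, h1, h2, h3⟩

theorem homDensity_reverse (hanti : ∀ x y, U x y = -U y x) (H : OrientedGraph V)
    {R : Finset (V × V)} (hR : R ⊆ H.edgeFinset) :
    (H.reverse R).homDensity U = (-1) ^ R.card * H.homDensity U := by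
  classical
  rw [homDensity, homDensity, ← integral_const_mul]
  refine integral_congr_ae (ae_of_all _ fun x => ?_)
  simp only
  rw [edgeFinset_reverse H R, Finset.prod_image (injOn_reverseEdge H R),
    ← Finset.prod_const, ← Finset.inter_eq_right.mpr hR, ← Finset.filter_mem_eq_inter,
    Finset.prod_filter, ← Finset.prod_mul_distrib]
  refine Finset.prod_congr rfl fun e _ => ?_
  unfold reverseEdge
  simp only [Finset.filter_mem_eq_inter, Finset.inter_eq_right.mpr hR]
  split_ifs
  · rw [hanti]
    simp
  · simp

/-- Forgetting coordinates of a product of probability measures leaves the product over the others;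
this is why isolated vertices do not affect densities. -/
theorem map_comp_embedding_volume (f : V' ↪ V) :
    Measure.map (fun (x : V → I) v => x (f v)) volume = (volume : Measure (V' → I)) := by
  classical
  symm
  refine Measure.pi_eq fun s hs => ?_
  rw [Measure.map_apply (by fun_prop) (MeasurableSet.univ_pi hs)]
  have : (fun (x : V → I) v => x (f v)) ⁻¹' Set.univ.pi s =
      Set.univ.pi fun j => {y : I | ∀ i, f i = j → y ∈ s i} := by
    ext x
    simp only [Set.mem_preimage, Set.mem_univ_pi, Set.mem_ofPred_eq]
    exact ⟨fun h j i hij => hij ▸ h i, fun h i => h _ i rfl⟩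
  rw [this, volume_pi_pi, ← Finset.prod_subset (Finset.subset_univ (Finset.univ.map f))]
  · rw [Finset.prod_map]
    refine Finset.prod_congr rfl fun i _ => ?_
    congr 1
    ext y
    simp
  · intro j _ hj
    have : {y : I | ∀ i, f i = j → y ∈ s i} = Set.univ := by
      ext y
      simp only [Set.mem_ofPred_eq, Set.mem_univ, iff_true]
      exact fun i hi => absurd (Finset.mem_map.mpr ⟨i, Finset.mem_univ _, hi⟩) hj
    rw [this, measure_univ]

theorem isBoundedMeasurable_prod_edges (hU : IsKernel U) (H : OrientedGraph V) :
    IsBoundedMeasurable fun x : V → I => ∏ e ∈ H.edgeFinset, U (x e.1) (x e.2) :=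
  IsBoundedMeasurable.prod _ fun e _ => hU.comp (by fun_prop) (by fun_prop)

theorem homDensity_of_isPadding (hU : IsKernel U) {H : OrientedGraph V'} {G : OrientedGraph V}
    (h : H.IsPadding G) : G.homDensity U = H.homDensity U := by
  classical
  obtain ⟨f, hf⟩ := h
  have hm : Measurable fun (x : V → I) v => x (f v) :=
    measurable_pi_lambda _ fun v => measurable_pi_apply (f v)
  rw [homDensity, homDensity, ← map_comp_embedding_volume f, integral_map hm.aemeasurable
    (isBoundedMeasurable_prod_edges hU H).1.aestronglyMeasurable, edgeFinset_of_isPadding hf]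
  simp only [Finset.prod_map]
  rfl

theorem EvenReversalOf.homDensity_eq (hU : IsKernel U) (hanti : ∀ x y, U x y = -U y x)
    {G : OrientedGraph V} {H : OrientedGraph V'} (h : G.EvenReversalOf H) :
    G.homDensity U = H.homDensity U := by
  obtain ⟨R, hR, he, hp⟩ := h
  rw [homDensity_of_isPadding hU hp, homDensity_reverse hanti H hR, he.neg_one_pow, one_mul]

theorem OddReversalOf.homDensity_eq (hU : IsKernel U) (hanti : ∀ x y, U x y = -U y x)
    {G : OrientedGraph V} {H : OrientedGraph V'} (h : G.OddReversalOf H) :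
    G.homDensity U = -H.homDensity U := by
  obtain ⟨R, hR, he, hp⟩ := h
  rw [homDensity_of_isPadding hU hp, homDensity_reverse hanti H hR, he.neg_one_pow, neg_one_mul]

/-- The underlying simple graphs of `H` and `G` agree up to isolated vertices. -/
def IsUPadding {V' V : Type*} (H : OrientedGraph V') (G : OrientedGraph V) : Prop :=
  ∃ f : V' ↪ V, ∀ a b, G.UAdj a b ↔ ∃ v w, f v = a ∧ f w = b ∧ H.UAdj v w

omit [Fintype V] in
-- Two orientations of the same simple graph differ by reversing the set R of edges on which they
-- disagree, and R has one of the two parities. Up to sign, densities in an antisymmetric kernel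
-- therefore depend only on the underlying graph.
theorem evenReversalOf_or_oddReversalOf_iff {G : OrientedGraph V} {H : OrientedGraph V'} :
    G.EvenReversalOf H ∨ G.OddReversalOf H ↔ H.IsUPadding G := by
  classical
  constructor
  · intro h
    obtain ⟨R, hR, f, hf⟩ : ∃ R ⊆ H.edgeFinset, (H.reverse R).IsPadding G := by
      rcases h with ⟨R, hR, -, hp⟩ | ⟨R, hR, -, hp⟩ <;> exact ⟨R, hR, hp⟩
    refine ⟨f, fun a b => ?_⟩
    simp only [UAdj, hf, reverse]
    constructor
    · rintro (⟨v, w, h1, h2, h3⟩ | ⟨v, w, h1, h2, h3⟩)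
      · exact ⟨v, w, h1, h2, by tauto⟩
      · exact ⟨w, v, h2, h1, by tauto⟩
    · rintro ⟨v, w, h1, h2, h3 | h3⟩
      · by_cases hm : (v, w) ∈ R
        · exact Or.inr ⟨w, v, h2, h1, by tauto⟩
        · exact Or.inl ⟨v, w, h1, h2, by tauto⟩
      · by_cases hm : (w, v) ∈ R
        · exact Or.inl ⟨v, w, h1, h2, by tauto⟩
        · exact Or.inr ⟨w, v, h2, h1, by tauto⟩
  · rintro ⟨f, hf⟩
    let R := H.edgeFinset.filter fun e => ¬ G.Adj (f e.1) (f e.2)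
    have hR : ∀ v w, (v, w) ∈ R ↔ H.Adj v w ∧ ¬ G.Adj (f v) (f w) := fun v w => by
      simp [R, mem_edgeFinset]
    have hp : (H.reverse R).IsPadding G := by
      refine ⟨f, fun a b => ?_⟩
      simp only [reverse, hR]
      constructor
      · intro h
        obtain ⟨v, w, rfl, rfl, h'⟩ := (hf a b).mp (Or.inl h)
        refine ⟨v, w, rfl, rfl, ?_⟩
        have := G.asymm _ _ h
        unfold UAdj at h'
        tauto
      · rintro ⟨v, w, rfl, rfl, h⟩
        have h1 := (hf (f v) (f w)).mpr ⟨v, w, rfl, rfl, by unfold UAdj; tauto⟩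
        unfold UAdj at h1
        tauto
    rcases Nat.even_or_odd R.card with h | h
    · exact Or.inl ⟨R, Finset.filter_subset _ _, h, hp⟩
    · exact Or.inr ⟨R, Finset.filter_subset _ _, h, hp⟩

theorem IsUPadding.card_edgeFinset_eq {G : OrientedGraph V} {H : OrientedGraph V'}
    (h : H.IsUPadding G) : G.edgeFinset.card = H.edgeFinset.card := by
  classical
  obtain ⟨R, hR, f, hf⟩ : ∃ R ⊆ H.edgeFinset, (H.reverse R).IsPadding G := by
    rcases evenReversalOf_or_oddReversalOf_iff.mpr h with ⟨R, hR, -, hp⟩ | ⟨R, hR, -, hp⟩ <;>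
      exact ⟨R, hR, hp⟩
  rw [edgeFinset_of_isPadding hf, Finset.card_map, edgeFinset_reverse H R,
    Finset.card_image_of_injOn (injOn_reverseEdge H R)]

theorem IsUPadding.abs_homDensity_eq (hU : IsKernel U) (hanti : ∀ x y, U x y = -U y x)
    {G : OrientedGraph V} {H : OrientedGraph V'} (h : H.IsUPadding G) :
    |G.homDensity U| = |H.homDensity U| := by
  rcases evenReversalOf_or_oddReversalOf_iff.mpr h with h | h
  · rw [h.homDensity_eq hU hanti]
  · rw [h.homDensity_eq hU hanti, abs_neg]

theorem edgeFinset_spanning (C : OrientedGraph V) {F : Finset (V × V)} (hF : F ⊆ C.edgeFinset) :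
    (C.spanning F).edgeFinset = F := by
  ext e
  simp only [mem_edgeFinset, spanning]
  exact ⟨fun h => h.2, fun h => ⟨(mem_edgeFinset C e).mp (hF h), h⟩⟩

end

section disjUnion

variable {ι : Type*} [Fintype ι] {V : ι → Type*} [∀ i, Fintype (V i)]

theorem map_sigmaUncurry_volume :
    Measure.map (fun (x : ∀ i, V i → I) (p : Σ i, V i) => x p.1 p.2) volume = volume := by
  symm
  refine Measure.pi_eq fun s hs => ?_
  rw [Measure.map_apply (by fun_prop) (MeasurableSet.univ_pi hs)]
  have : (fun (x : ∀ i, V i → I) (p : Σ i, V i) => x p.1 p.2) ⁻¹' Set.univ.pi s =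
      Set.univ.pi fun i => Set.univ.pi fun j => s ⟨i, j⟩ := by
    ext x
    simp only [Set.mem_preimage, Set.mem_univ_pi, Sigma.forall]
  rw [this, volume_pi_pi, Fintype.prod_sigma]
  exact Finset.prod_congr rfl fun i _ => volume_pi_pi _

open scoped Classical in
theorem edgeFinset_disjUnion (H : ∀ i, OrientedGraph (V i)) :
    (disjUnion H).edgeFinset = (Finset.univ.sigma fun i => (H i).edgeFinset).image
      fun p => (⟨p.1, p.2.1⟩, ⟨p.1, p.2.2⟩) := by
  ext ⟨a, b⟩
  simp only [mem_edgeFinset, disjUnion, Finset.mem_image, Finset.mem_sigma, Finset.mem_univ,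
    true_and, Sigma.exists, Prod.exists, Prod.mk.injEq]
  constructor
  · rintro ⟨i, v, w, rfl, rfl, h⟩
    exact ⟨i, v, w, h, rfl, rfl⟩
  · rintro ⟨i, v, w, h, rfl, rfl⟩
    exact ⟨i, v, w, rfl, rfl, h⟩

omit [Fintype ι] [∀ i, Fintype (V i)] in
theorem sigma_prod_injective : Function.Injective
    fun p : Σ i, V i × V i => ((⟨p.1, p.2.1⟩, ⟨p.1, p.2.2⟩) : (Σ i, V i) × (Σ i, V i)) := by
  rintro ⟨i, v, w⟩ ⟨j, v', w'⟩ h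
  simp only [Prod.mk.injEq, Sigma.mk.injEq] at h
  obtain ⟨⟨rfl, h1⟩, -, h2⟩ := h
  cases h1
  cases h2
  rfl

theorem homDensity_disjUnion {U : I → I → ℝ} (hU : IsKernel U) (H : ∀ i, OrientedGraph (V i)) :
    (disjUnion H).homDensity U = ∏ i, (H i).homDensity U := by
  classical
  have hm : Measurable fun (x : ∀ i, V i → I) (p : Σ i, V i) => x p.1 p.2 :=
    measurable_pi_lambda _ fun p => (measurable_pi_apply p.2).comp (measurable_pi_apply p.1)
  rw [homDensity, ← map_sigmaUncurry_volume, integral_map hm.aemeasurable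
    (isBoundedMeasurable_prod_edges hU _).1.aestronglyMeasurable, edgeFinset_disjUnion]
  simp_rw [Finset.prod_image (sigma_prod_injective.injOn), Finset.prod_sigma]
  exact integral_fintype_prod_volume_eq_prod
    (fun i (x : V i → I) => ∏ e ∈ (H i).edgeFinset, U (x e.1) (x e.2))

theorem card_edgeFinset_disjUnion (H : ∀ i, OrientedGraph (V i)) :
    (disjUnion H).edgeFinset.card = ∑ i, (H i).edgeFinset.card := by
  classical
  rw [edgeFinset_disjUnion, Finset.card_image_of_injective _ sigma_prod_injective,
    Finset.card_sigma]

end disjUnion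

/-! ### Densities of paths and of the cycle `D` -/

/-- The path with `r` edges and all edges oriented in the same direction. -/
def directedPath (r : ℕ) : OrientedGraph (Fin (r + 1)) where
  Adj a b := b.val = a.val + 1
  asymm a b := by omega

theorem prod_edgeFinset_eq {V J : Type*} [Fintype V] [Fintype J] {H : OrientedGraph V}
    {φ : J → V × V} (hφ : Function.Injective φ) (h : ∀ v w, H.Adj v w ↔ ∃ j, φ j = (v, w))
    (f : V × V → ℝ) : ∏ e ∈ H.edgeFinset, f e = ∏ j, f (φ j) := by
  classical
  have : H.edgeFinset = Finset.univ.image φ := by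
    ext ⟨v, w⟩
    simp [mem_edgeFinset, h]
  rw [this, Finset.prod_image hφ.injOn]

theorem edgeFinset_directedPath (r : ℕ) : (directedPath r).edgeFinset =
    Finset.univ.image fun i : Fin r => (i.castSucc, i.succ) := by
  ext ⟨a, b⟩
  simp only [mem_edgeFinset, directedPath, Finset.mem_image, Finset.mem_univ, true_and,
    Prod.mk.injEq]
  constructor
  · intro h
    exact ⟨⟨a, by omega⟩, Fin.ext rfl, Fin.ext h.symm⟩
  · rintro ⟨i, rfl, rfl⟩
    simp

theorem homDensity_directedPath {U : I → I → ℝ} (hU : IsKernel U) (r : ℕ) :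
    (directedPath r).homDensity U = ∫ x, (kernelOp U)^[r] (fun _ => 1) x := by
  rw [homDensity, edgeFinset_directedPath]
  have hinj : Function.Injective fun i : Fin r => (i.castSucc, i.succ) := fun i j h =>
    Fin.castSucc_injective _ (Prod.mk.inj h).1
  simp_rw [Finset.prod_image hinj.injOn]
  cases r with
  | zero => simp
  | succ r => exact integral_prod_path hU r

theorem card_edgeFinset_directedPath (r : ℕ) : (directedPath r).edgeFinset.card = r := by
  rw [edgeFinset_directedPath, Finset.card_image_of_injective _
    (fun i j h => Fin.castSucc_injective _ (Prod.mk.inj h).1), Finset.card_univ, Fintype.card_fin]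

theorem directedPath_uAdj_iff (r : ℕ) (a b : Fin (r + 1)) :
    (directedPath r).UAdj a b ↔ b.val = a.val + 1 ∨ a.val = b.val + 1 := Iff.rfl

theorem Q_uAdj_iff (n : ℕ) (a b : Fin (2 * n + 1)) :
    (Q n).UAdj a b ↔ b.val = a.val + 1 ∨ a.val = b.val + 1 := by
  simp only [UAdj, Q]
  omega

/-- Reversing the first n edges of the directed path yields `Q n`, and the resulting (-1)^n cancels
the sign in `integral_iterate_two_mul`. -/
theorem homDensity_Q {U : I → I → ℝ} (hU : IsKernel U) (hanti : ∀ x y, U x y = -U y x) (n : ℕ) :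
    (Q n).homDensity U = iterateNormSq U n := by
  classical
  let R : Finset (Fin (2 * n + 1) × Fin (2 * n + 1)) :=
    Finset.univ.image fun i : Fin n => (⟨i, by omega⟩, ⟨i + 1, by omega⟩)
  have hR : ∀ a b, (a, b) ∈ R ↔ a.val < n ∧ b.val = a.val + 1 := fun a b => by
    simp only [R, Finset.mem_image, Finset.mem_univ, true_and, Prod.mk.injEq]
    constructor
    · rintro ⟨i, rfl, rfl⟩
      simp
    · rintro ⟨h1, h2⟩
      exact ⟨⟨a, h1⟩, Fin.ext rfl, Fin.ext h2.symm⟩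
  have hsub : R ⊆ (directedPath (2 * n)).edgeFinset := by
    rintro ⟨a, b⟩ h
    rw [hR] at h
    rw [mem_edgeFinset]
    exact h.2
  have hcard : R.card = n := by
    rw [Finset.card_image_of_injective, Finset.card_univ, Fintype.card_fin]
    intro i j h
    simpa [Fin.ext_iff] using h
  have hQ : Q n = (directedPath (2 * n)).reverse R := by
    have : (Q n).Adj = ((directedPath (2 * n)).reverse R).Adj := by
      ext a b
      simp only [Q, reverse, hR, directedPath]
      omega
    cases hq : Q n
    cases hr : (directedPath (2 * n)).reverse R
    rw [hq, hr] at this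
    simp only at this
    congr 1
    exact Digraph.ext this
  rw [hQ, homDensity_reverse hanti _ hsub, homDensity_directedPath hU,
    integral_iterate_two_mul hU hanti, hcard, ← mul_assoc, ← mul_pow]
  simp

theorem card_edgeFinset_Q (n : ℕ) : (Q n).edgeFinset.card = 2 * n := by
  refine Eq.trans ?_ (card_edgeFinset_directedPath (2 * n))
  refine IsUPadding.card_edgeFinset_eq ⟨Function.Embedding.refl _, fun a b => ?_⟩
  simp [Q_uAdj_iff, directedPath_uAdj_iff]

/-- A walk once round the cycle meets k + 1 edges against their direction, and this sign cancels the
one in `integral_cycle`. The resulting nonnegativity is what singles out D_ℓ as the reference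
orientation. -/
theorem homDensity_D {U : I → I → ℝ} (hU : IsKernel U) (hanti : ∀ x y, U x y = -U y x) {k : ℕ}
    (hk : 1 ≤ k) : (D (k + 1)).homDensity U = ∫ x, ∫ y, kernelPow U k x y ^ 2 := by
  -- `none` indexes the closing edge between 0 and 2k + 1, and `some i` the edge between i and i +
  -- 1. For k ≥ 1 these are all distinct.
  let φ : Option (Fin (2 * k + 1)) → Fin (2 * k + 2) × Fin (2 * k + 2) := fun j =>
    j.elim (0, Fin.last _) fun i =>
      if i.val < k + 1 then (i.castSucc, i.succ) else (i.succ, i.castSucc)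
  have hn1 : (φ none).1.val = 0 := rfl
  have hn2 : (φ none).2.val = 2 * k + 1 := rfl
  have hs : ∀ i : Fin (2 * k + 1), (i.val < k + 1 ∧ (φ (some i)).1.val = i.val ∧
      (φ (some i)).2.val = i.val + 1) ∨ (k + 1 ≤ i.val ∧ (φ (some i)).1.val = i.val + 1 ∧
      (φ (some i)).2.val = i.val) := fun i => by
    simp only [φ, Option.elim]
    split_ifs with h
    · exact Or.inl ⟨h, rfl, rfl⟩
    · exact Or.inr ⟨by omega, rfl, rfl⟩
  have hφ : Function.Injective φ := by
    intro i j h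
    have h1 : (φ i).1.val = (φ j).1.val := congrArg (fun p => p.1.val) h
    have h2 : (φ i).2.val = (φ j).2.val := congrArg (fun p => p.2.val) h
    rcases i with _ | i <;> rcases j with _ | j
    · rfl
    · have := hs j
      omega
    · have := hs i
      omega
    · have h3 := hs i
      have h4 := hs j
      congr 1
      apply Fin.ext
      omega
  have hadj : ∀ v w, (D (k + 1)).Adj v w ↔ ∃ j, φ j = (v, w) := by
    intro v w
    have hval : ∀ j, φ j = (v, w) ↔ (φ j).1.val = v.val ∧ (φ j).2.val = w.val := fun j =>
      ⟨fun h => by rw [h]; exact ⟨rfl, rfl⟩, fun h => Prod.ext (Fin.ext h.1) (Fin.ext h.2)⟩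
    simp only [D, hval]
    constructor
    · rintro (⟨h1, h2⟩ | ⟨h1, h2⟩ | ⟨h1, h2⟩)
      · refine ⟨some ⟨v, by omega⟩, ?_⟩
        have := hs ⟨v, by omega⟩
        simp only at this
        omega
      · refine ⟨some ⟨w, by omega⟩, ?_⟩
        have := hs ⟨w, by omega⟩
        simp only at this
        omega
      · exact ⟨none, by omega, by omega⟩
    · rintro ⟨_ | i, h⟩
      · omega
      · have := hs i
        omega
  have hsign : ∏ i : Fin (2 * k + 1), (if i.val < k + 1 then (1 : ℝ) else -1) = (-1) ^ k := by
    rw [Fin.prod_univ_eq_prod_range (fun i => if i < k + 1 then (1 : ℝ) else -1),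
      show 2 * k + 1 = (k + 1) + k by ring, Finset.prod_range_add,
      Finset.prod_congr rfl (g := fun _ => (1 : ℝ)) fun i hi => by simp [Finset.mem_range.mp hi],
      Finset.prod_congr (s₁ := Finset.range k) rfl (g := fun _ => (-1 : ℝ)) fun i _ =>
        if_neg (by omega)]
    simp
  have hprod : ∀ x : Fin (2 * k + 2) → I,
      ∏ e ∈ (D (k + 1)).edgeFinset, U (x e.1) (x e.2) = (-1) ^ (k + 1) *
        ((∏ i : Fin (2 * k + 1), U (x i.castSucc) (x i.succ)) * U (x (Fin.last _)) (x 0)) := by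
    intro x
    refine (prod_edgeFinset_eq hφ hadj (fun e => U (x e.1) (x e.2))).trans ?_
    rw [Fintype.prod_option, pow_succ, ← hsign]
    have : ∏ i : Fin (2 * k + 1), U (x (φ (some i)).1) (x (φ (some i)).2) =
        ∏ i : Fin (2 * k + 1), (if i.val < k + 1 then (1 : ℝ) else -1) *
          U (x i.castSucc) (x i.succ) := by
      refine Finset.prod_congr rfl fun i _ => ?_
      simp only [φ, Option.elim]
      split_ifs
      · simp
      · rw [hanti]
        simp
    rw [this, Finset.prod_mul_distrib]
    simp only [φ, Option.elim]
    rw [hanti (x 0)]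
    ring
  have h := integral_prod_path_mul hU (2 * k) (G := fun x y => U y x)
    (hU.comp measurable_snd measurable_fst)
  rw [integral_cycle hU hanti] at h
  have h2 : (D (k + 1)).homDensity U = ∫ x : Fin (2 * k + 2) → I, (-1) ^ (k + 1) *
        ((∏ i : Fin (2 * k + 1), U (x i.castSucc) (x i.succ)) * U (x (Fin.last _)) (x 0)) :=
    integral_congr_ae (ae_of_all _ hprod)
  rw [h2, integral_const_mul, h, ← mul_assoc, ← mul_pow]
  simp

end OrientedGraph

/-! ### Proper subgraphs of a cycle -/

/-- The maximal runs of a proper subset of a cyclic group. -/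
theorem exists_cyclic_runs {ℓ : ℕ} [NeZero ℓ] {S : Set (ZMod ℓ)} (hS : S ≠ Set.univ) :
    ∃ (ι : Type) (_ : Fintype ι) (r : ι → ℕ) (f : (Σ i, Fin (r i + 1)) ↪ ZMod ℓ),
      (∀ i, 1 ≤ r i) ∧
      (∀ i (j : Fin (r i)), f ⟨i, j.succ⟩ = f ⟨i, j.castSucc⟩ + 1) ∧
      ∀ a, a ∈ S ↔ ∃ i, ∃ j : Fin (r i), f ⟨i, j.castSucc⟩ = a := by
  classical
  obtain ⟨b, hb⟩ : ∃ b, b ∉ S := by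
    by_contra! h
    exact hS (Set.eq_univ_of_forall h)
  have hup : ∀ a : ZMod ℓ, ∃ r : ℕ, a + r ∉ S := fun a =>
    ⟨(b - a).val, by simpa using hb⟩
  have hdown : ∀ a : ZMod ℓ, ∃ r : ℕ, a - r ∉ S := fun a =>
    ⟨(a - b).val, by simpa using hb⟩
  -- A run is named by its first element and `r` is its length. An element a stands for the edge
  -- from a to a + 1, so a run of r elements occupies r + 1 points.
  let ι := {a : ZMod ℓ // a ∈ S ∧ a - 1 ∉ S}
  let r : ι → ℕ := fun a => Nat.find (hup a.1)
  have hr1 : ∀ i (j : ℕ), j < r i → i.1 + j ∈ S := fun i j hj => by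
    simpa using Nat.find_min (hup i.1) hj
  have hr2 : ∀ i : ι, i.1 + (r i : ℕ) ∉ S := fun i => Nat.find_spec (hup i.1)
  -- If j < j', then i - 1 would lie in the run of i', although i starts a run. Allowing j' = r i'
  -- means that different runs do not even share an end vertex.
  have hinj : ∀ (i i' : ι) (j j' : ℕ), j ≤ j' → j' ≤ r i' → i.1 + j = i'.1 + j' →
      j = j' ∧ i = i' := by
    intro i i' j j' hjj hj' h
    rcases hjj.eq_or_lt with rfl | hlt
    · exact ⟨rfl, Subtype.ext (add_right_cancel h)⟩
    · exfalso
      refine i.2.2 ?_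
      have h1 := hr1 i' (j' - j - 1) (by omega)
      have h2 : ((j' - j - 1 : ℕ) : ZMod ℓ) = j' - j - 1 := by
        rw [Nat.cast_sub (by omega), Nat.cast_sub (by omega), Nat.cast_one]
      rw [h2] at h1
      rwa [show i.1 - 1 = i'.1 + (j' - j - 1) by linear_combination h]
  have hfinj : Function.Injective
      fun p : Σ i : ι, Fin (r i + 1) => p.1.1 + (p.2.val : ZMod ℓ) := by
    rintro ⟨i, j⟩ ⟨i', j'⟩ h
    simp only at h
    rcases le_total j.val j'.val with hle | hle
    · obtain ⟨h1, rfl⟩ := hinj i i' j j' hle (by omega) h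
      rw [Fin.ext h1]
    · obtain ⟨h1, rfl⟩ := hinj i' i j' j hle (by omega) h.symm
      rw [Fin.ext h1]
  refine ⟨ι, inferInstance, r, ⟨_, hfinj⟩, ?_, ?_, ?_⟩
  · intro i
    by_contra h0
    have h1 := hr2 i
    rw [show r i = 0 by omega, Nat.cast_zero, add_zero] at h1
    exact h1 i.2.1
  · intro i j
    change i.1 + ((j.val + 1 : ℕ) : ZMod ℓ) = i.1 + (j.val : ZMod ℓ) + 1
    push_cast
    ring
  · intro a
    constructor
    · intro ha
      have hd1 := Nat.find_spec (hdown a)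
      have hd2 : ∀ j < Nat.find (hdown a), a - j ∈ S := fun j hj => by
        simpa using Nat.find_min (hdown a) hj
      set d := Nat.find (hdown a)
      obtain ⟨t, ht⟩ : ∃ t, d = t + 1 := by
        refine Nat.exists_eq_succ_of_ne_zero fun h0 => ?_
        rw [h0, Nat.cast_zero, sub_zero] at hd1
        exact hd1 ha
      let i : ι := ⟨a - t, hd2 t (by omega), by
        rw [ht] at hd1
        push_cast at hd1
        rwa [sub_sub]⟩
      have hlt : t < r i := by
        by_contra! hle
        refine hr2 i ?_
        have := hd2 (t - r i) (by omega)
        rw [Nat.cast_sub hle] at this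
        rwa [show i.1 + (r i : ZMod ℓ) = a - (t - r i) by simp only [i]; ring]
      exact ⟨i, ⟨t, hlt⟩, sub_add_cancel a (t : ZMod ℓ)⟩
    · rintro ⟨i, j, rfl⟩
      exact hr1 i j j.2

namespace OrientedGraph

theorem IsUPadding.trans {V₁ V₂ V₃ : Type*} {H₁ : OrientedGraph V₁} {H₂ : OrientedGraph V₂}
    {H₃ : OrientedGraph V₃} (h : H₁.IsUPadding H₂) (h' : H₂.IsUPadding H₃) :
    H₁.IsUPadding H₃ := by
  obtain ⟨f, hf⟩ := h
  obtain ⟨g, hg⟩ := h'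
  refine ⟨f.trans g, fun a b => ?_⟩
  rw [hg]
  constructor
  · rintro ⟨v, w, rfl, rfl, h⟩
    obtain ⟨v', w', rfl, rfl, h'⟩ := (hf _ _).mp h
    exact ⟨v', w', rfl, rfl, h'⟩
  · rintro ⟨v, w, rfl, rfl, h⟩
    exact ⟨f v, f w, rfl, rfl, (hf _ _).mpr ⟨v, w, rfl, rfl, h⟩⟩

theorem disjUnion_uAdj_iff {ι : Type*} {V : ι → Type*} (H : ∀ i, OrientedGraph (V i))
    (a b : Σ i, V i) :
    (disjUnion H).UAdj a b ↔ ∃ i v w, a = ⟨i, v⟩ ∧ b = ⟨i, w⟩ ∧ (H i).UAdj v w := by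
  simp only [UAdj, disjUnion]
  constructor
  · rintro (⟨i, v, w, h1, h2, h⟩ | ⟨i, v, w, h1, h2, h⟩)
    · exact ⟨i, v, w, h1, h2, Or.inl h⟩
    · exact ⟨i, w, v, h2, h1, Or.inr h⟩
  · rintro ⟨i, v, w, h1, h2, h | h⟩
    · exact Or.inl ⟨i, v, w, h1, h2, h⟩
    · exact Or.inr ⟨i, w, v, h2, h1, h⟩

theorem isUPadding_disjUnion_Q {ι κ : Type*} (n : ι → ℕ) (e : κ ≃ ι) :
    (disjUnion fun i => Q (n (e i))).IsUPadding (disjUnion fun i => directedPath (2 * n i)) := by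
  refine ⟨(Equiv.sigmaCongrLeft (β := fun i => Fin (2 * n i + 1)) e).toEmbedding, fun a b => ?_⟩
  simp only [disjUnion_uAdj_iff, Q_uAdj_iff, directedPath_uAdj_iff]
  constructor
  · rintro ⟨i, v, w, rfl, rfl, h⟩
    obtain ⟨j, rfl⟩ := e.surjective i
    exact ⟨⟨j, v⟩, ⟨j, w⟩, rfl, rfl, j, v, w, rfl, rfl, h⟩
  · rintro ⟨_, _, rfl, rfl, j, v, w, rfl, rfl, h⟩
    exact ⟨e j, v, w, rfl, rfl, h⟩

theorem sigma_fin_ext {ι : Type*} {m : ι → ℕ} {p q : Σ i, Fin (m i)} (h1 : p.1 = q.1)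
    (h2 : p.2.val = q.2.val) : p = q := by
  obtain ⟨i, v⟩ := p
  obtain ⟨j, w⟩ := q
  obtain rfl : i = j := h1
  rw [show v = w from Fin.ext h2]

/-! ### Uniqueness of the decomposition into even paths -/

section uniqueness

variable {V : Type*} {G : OrientedGraph V} {k k' : ℕ} {n : Fin k → ℕ} {n' : Fin k' → ℕ}
  {f : (Σ i, Fin (2 * n i + 1)) ↪ V} {f' : (Σ i, Fin (2 * n' i + 1)) ↪ V}
  (hf : ∀ a b, G.UAdj a b ↔ ∃ v w, f v = a ∧ f w = b ∧ (disjUnion fun i => Q (n i)).UAdj v w)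
  (hf' : ∀ a b, G.UAdj a b ↔ ∃ v w, f' v = a ∧ f' w = b ∧ (disjUnion fun i => Q (n' i)).UAdj v w)

include hf hf'

/-- Paths of positive length have no isolated vertices, so every vertex in the image of f lies on an
edge of G and is hit by f' as well. -/
theorem exists_map_of_isUPadding (hn : ∀ i, 1 ≤ n i) :
    ∃ e : (Σ i, Fin (2 * n i + 1)) → Σ i, Fin (2 * n' i + 1), ∀ p, f' (e p) = f p := by
  suffices h : ∀ p, ∃ q, f' q = f p by
    choose e he using h
    exact ⟨e, he⟩
  rintro ⟨i, v⟩
  obtain ⟨w, hw⟩ : ∃ w : Fin (2 * n i + 1), w.val = v.val + 1 ∨ v.val = w.val + 1 := by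
    have := hn i
    by_cases h : v.val = 0
    · exact ⟨⟨1, by omega⟩, by simp [h]⟩
    · exact ⟨⟨v - 1, by omega⟩, by simp only; omega⟩
  have h : G.UAdj (f ⟨i, v⟩) (f ⟨i, w⟩) := (hf _ _).mpr ⟨_, _, rfl, rfl,
    (disjUnion_uAdj_iff _ _ _).mpr ⟨i, v, w, rfl, rfl, (Q_uAdj_iff _ _ _).mpr hw⟩⟩
  obtain ⟨q, _, hq, -, -⟩ := (hf' _ _).mp h
  exact ⟨q, hq⟩

/-- A path is connected, so it is carried into a single component; counting vertices compares the
lengths. -/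
theorem map_component_of_isUPadding {e : (Σ i, Fin (2 * n i + 1)) → Σ i, Fin (2 * n' i + 1)}
    (he : ∀ p, f' (e p) = f p) (i : Fin k) :
    (∀ v, (e ⟨i, v⟩).1 = (e ⟨i, 0⟩).1) ∧ n i ≤ n' (e ⟨i, 0⟩).1 := by
  have h1 : ∀ v, (e ⟨i, v⟩).1 = (e ⟨i, 0⟩).1 := by
    intro v
    induction v using Fin.induction with
    | zero => rfl
    | succ v ih =>
      rw [← ih]
      have h : G.UAdj (f ⟨i, v.castSucc⟩) (f ⟨i, v.succ⟩) := (hf _ _).mpr ⟨_, _, rfl, rfl,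
        (disjUnion_uAdj_iff _ _ _).mpr ⟨i, _, _, rfl, rfl, (Q_uAdj_iff _ _ _).mpr (by simp)⟩⟩
      obtain ⟨q, q', hq, hq', hqq⟩ := (hf' _ _).mp h
      rw [← he] at hq hq'
      rw [← f'.injective hq, ← f'.injective hq']
      obtain ⟨j, v, w, rfl, rfl, -⟩ := (disjUnion_uAdj_iff _ _ _).mp hqq
      rfl
  refine ⟨h1, ?_⟩
  have hc := Fintype.card_le_of_injective
    (fun v : Fin (2 * n i + 1) => (⟨(e ⟨i, v⟩).2.val, lt_of_lt_of_eq (e ⟨i, v⟩).2.2 (by rw [h1 v])⟩ : Fin (2 * n' (e ⟨i, 0⟩).1 + 1))) (fun v w h => by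
        have h2 : e ⟨i, v⟩ = e ⟨i, w⟩ :=
          sigma_fin_ext ((h1 v).trans (h1 w).symm) (Fin.ext_iff.mp h)
        have h3 : f ⟨i, v⟩ = f ⟨i, w⟩ := by rw [← he, ← he, h2]
        simpa using f.injective h3)
  simp only [Fintype.card_fin] at hc
  omega

end uniqueness

/-- Ensures that an edge set F is counted in α_C for at most one tuple. The component maps in both
directions are mutually inverse and preserve lengths, and a sorted tuple is determined by its
entries with multiplicity. -/
theorem isUPadding_disjUnion_Q_unique {V : Type*} {G : OrientedGraph V} {k k' : ℕ}
    {n : Fin k → ℕ} {n' : Fin k' → ℕ} (hn : ∀ i, 1 ≤ n i) (hn' : ∀ i, 1 ≤ n' i)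
    (hm : Monotone n) (hm' : Monotone n') (h : (disjUnion fun i => Q (n i)).IsUPadding G)
    (h' : (disjUnion fun i => Q (n' i)).IsUPadding G) :
    (⟨k, n⟩ : Σ k, Fin k → ℕ) = ⟨k', n'⟩ := by
  obtain ⟨f, hf⟩ := h
  obtain ⟨f', hf'⟩ := h'
  obtain ⟨e, he⟩ := exists_map_of_isUPadding hf hf' hn
  obtain ⟨e', he'⟩ := exists_map_of_isUPadding hf' hf hn'
  have hc := map_component_of_isUPadding hf hf' he
  have hc' := map_component_of_isUPadding hf' hf he'
  have hee : ∀ p, e' (e p) = p := fun p => f.injective (by rw [he', he])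
  have hee' : ∀ p, e (e' p) = p := fun p => f'.injective (by rw [he, he'])
  let τ : Fin k ≃ Fin k' :=
    { toFun := fun i => (e ⟨i, 0⟩).1
      invFun := fun j => (e' ⟨j, 0⟩).1
      left_inv := fun i => by
        simp only
        rw [← (hc' (e ⟨i, 0⟩).1).1 (e ⟨i, 0⟩).2]
        exact congrArg Sigma.fst (hee ⟨i, 0⟩)
      right_inv := fun j => by
        simp only
        rw [← (hc (e' ⟨j, 0⟩).1).1 (e' ⟨j, 0⟩).2]
        exact congrArg Sigma.fst (hee' ⟨j, 0⟩) }
  have hk : k = k' := by simpa using Fintype.card_congr τ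
  subst hk
  have hnn : n = n' ∘ τ := by
    funext i
    refine le_antisymm (hc i).2 ?_
    have := (hc' (τ i)).2
    rwa [show (e' ⟨τ i, 0⟩).1 = i from τ.left_inv i] at this
  have : n' ∘ τ = n' ∘ (Equiv.refl _ : Equiv.Perm (Fin k)) :=
    Tuple.unique_monotone (hnn ▸ hm) hm'
  rw [hnn, this]
  rfl

/-! ### Orientations of cycles -/

theorem IsCycleOrientation.exists_equiv {V : Type*} {C : OrientedGraph V} {ℓ : ℕ}
    (hC : C.IsCycleOrientation ℓ) :
    ∃ ψ : ZMod ℓ ≃ V, ∀ a b, C.UAdj (ψ a) (ψ b) ↔ b = a + 1 ∨ a = b + 1 := by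
  obtain ⟨h3, ⟨φ⟩⟩ := hC
  obtain ⟨m, rfl⟩ : ∃ m, ℓ = m + 2 := ⟨ℓ - 2, by omega⟩
  refine ⟨φ.toEquiv.symm, fun a b => ?_⟩
  have h : C.toSimpleGraphInclusive.Adj (φ.symm a) (φ.symm b) ↔ a - b = 1 ∨ b - a = 1 :=
    φ.symm.map_adj_iff (v := a) (w := b)
  rw [sub_eq_iff_eq_add', sub_eq_iff_eq_add'] at h
  simp only [Digraph.toSimpleGraphInclusive, SimpleGraph.fromRel_adj] at h
  have hne : C.UAdj (φ.toEquiv.symm a) (φ.toEquiv.symm b) →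
      φ.toEquiv.symm a ≠ φ.toEquiv.symm b := by
    intro h1 h2
    rw [h2] at h1
    have := C.asymm (φ.toEquiv.symm b) (φ.toEquiv.symm b)
    unfold UAdj at h1
    tauto
  constructor
  · intro h1
    have := h.mp ⟨hne h1, h1⟩
    exact this.symm
  · intro h1
    exact (h.mpr h1.symm).2

open scoped Classical in
/-- The edge of `C` between `ψ a` and `ψ (a + 1)`. -/
noncomputable def cycleEdge {V : Type*} (C : OrientedGraph V) {ℓ : ℕ} (ψ : ZMod ℓ ≃ V)
    (a : ZMod ℓ) : V × V :=
  if C.Adj (ψ a) (ψ (a + 1)) then (ψ a, ψ (a + 1)) else (ψ (a + 1), ψ a)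

section cycle

variable {V : Type*} [Fintype V] {C : OrientedGraph V} {ℓ : ℕ} {ψ : ZMod ℓ ≃ V}
  (hψ : ∀ a b, C.UAdj (ψ a) (ψ b) ↔ b = a + 1 ∨ a = b + 1)

include hψ

theorem cycleEdge_mem (a : ZMod ℓ) : cycleEdge C ψ a ∈ C.edgeFinset := by
  rw [mem_edgeFinset]
  unfold cycleEdge
  split_ifs with h
  · exact h
  · exact ((hψ a (a + 1)).mpr (Or.inl rfl)).resolve_left h

theorem exists_cycleEdge {e : V × V} (he : e ∈ C.edgeFinset) : ∃ a, cycleEdge C ψ a = e := by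
  obtain ⟨v, w⟩ := e
  obtain ⟨a, rfl⟩ := ψ.surjective v
  obtain ⟨b, rfl⟩ := ψ.surjective w
  rw [mem_edgeFinset] at he
  rcases (hψ a b).mp (Or.inl he) with rfl | rfl
  · exact ⟨a, if_pos he⟩
  · exact ⟨b, if_neg (C.asymm _ _ he)⟩

theorem spanning_uAdj_iff {F : Finset (V × V)} (v w : V) :
    (C.spanning F).UAdj v w ↔ ∃ a, cycleEdge C ψ a ∈ F ∧
      ((v = ψ a ∧ w = ψ (a + 1)) ∨ (v = ψ (a + 1) ∧ w = ψ a)) := by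
  classical
  constructor
  · have key : ∀ v w, (C.spanning F).Adj v w → ∃ a, cycleEdge C ψ a ∈ F ∧
      ((v = ψ a ∧ w = ψ (a + 1)) ∨ (v = ψ (a + 1) ∧ w = ψ a)) := by
      rintro v w ⟨h1, h2⟩
      obtain ⟨a, ha⟩ := exists_cycleEdge hψ ((mem_edgeFinset C (v, w)).mpr h1)
      refine ⟨a, by rwa [ha], ?_⟩
      unfold cycleEdge at ha
      split_ifs at ha <;> obtain ⟨rfl, rfl⟩ := Prod.mk.inj ha <;> simp
    rintro (h | h)
    · exact key v w h
    · obtain ⟨a, h1, h2⟩ := key w v h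
      exact ⟨a, h1, by tauto⟩
  · rintro ⟨a, h1, h2⟩
    have h3 := cycleEdge_mem hψ a
    rw [mem_edgeFinset] at h3
    unfold cycleEdge at h1 h3
    simp only [UAdj, spanning]
    rcases h2 with ⟨rfl, rfl⟩ | ⟨rfl, rfl⟩ <;> split_ifs at h1 h3 <;> tauto

theorem exists_directedPaths [NeZero ℓ] {F : Finset (V × V)} (hF : F ⊆ C.edgeFinset)
    (hne : F ≠ C.edgeFinset) : ∃ (ι : Type) (_ : Fintype ι) (r : ι → ℕ), (∀ i, 1 ≤ r i) ∧
      (disjUnion fun i => directedPath (r i)).IsUPadding (C.spanning F) := by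
  obtain ⟨ι, hι, r, f, hr, hf, hS⟩ := exists_cyclic_runs (S := {a | cycleEdge C ψ a ∈ F}) (by
    intro h
    refine hne (hF.antisymm fun e he => ?_)
    obtain ⟨a, rfl⟩ := exists_cycleEdge hψ he
    exact (h.symm ▸ Set.mem_univ a : a ∈ {a | cycleEdge C ψ a ∈ F}))
  refine ⟨ι, hι, r, hr, f.trans ψ.toEmbedding, fun v w => ?_⟩
  rw [spanning_uAdj_iff hψ]
  constructor
  · rintro ⟨a, ha, h⟩
    obtain ⟨i, j, rfl⟩ := (hS a).mp ha
    rw [← hf] at h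
    rcases h with ⟨rfl, rfl⟩ | ⟨rfl, rfl⟩
    · exact ⟨_, _, rfl, rfl, (disjUnion_uAdj_iff _ _ _).mpr ⟨i, _, _, rfl, rfl, by
        simp [directedPath_uAdj_iff]⟩⟩
    · exact ⟨_, _, rfl, rfl, (disjUnion_uAdj_iff _ _ _).mpr ⟨i, _, _, rfl, rfl, by
        simp [directedPath_uAdj_iff]⟩⟩
  · rintro ⟨p, q, rfl, rfl, h⟩
    obtain ⟨i, v, w, rfl, rfl, h'⟩ := (disjUnion_uAdj_iff _ _ _).mp h
    have key : ∀ v w : Fin (r i + 1), w.val = v.val + 1 →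
        cycleEdge C ψ (f ⟨i, v⟩) ∈ F ∧ f ⟨i, w⟩ = f ⟨i, v⟩ + 1 := by
      intro v w hvw
      let j : Fin (r i) := ⟨v, by omega⟩
      have hv : v = j.castSucc := Fin.ext rfl
      have hw : w = j.succ := Fin.ext hvw
      rw [hv, hw]
      exact ⟨(hS _).mpr ⟨i, j, rfl⟩, hf i j⟩
    rcases h' with h | h
    · obtain ⟨h1, h2⟩ := key v w h
      exact ⟨_, h1, Or.inl ⟨rfl, congrArg ψ h2⟩⟩
    · obtain ⟨h1, h2⟩ := key w v h
      exact ⟨_, h1, Or.inr ⟨congrArg ψ h2, rfl⟩⟩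

/-- The components with edges are the runs of F around the cycle. One run of odd length makes the
product of densities vanish; otherwise the half-lengths are sorted, and their bound by ℓ counts
vertices. -/
theorem homDensity_spanning_eq_zero_or [NeZero ℓ] {U : I → I → ℝ} (hU : IsKernel U)
    (hanti : ∀ x y, U x y = -U y x) {F : Finset (V × V)} (hF : F ⊆ C.edgeFinset)
    (hne : F ≠ C.edgeFinset) (h0 : F ≠ ∅) :
    (C.spanning F).homDensity U = 0 ∨ ∃ k, 1 ≤ k ∧ ∃ n ∈ pathTuples ℓ k,
      (disjUnion fun i => Q (n i)).IsUPadding (C.spanning F) := by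
  classical
  obtain ⟨ι, _, r, hr, hpad⟩ := exists_directedPaths hψ hF hne
  by_cases hodd : ∃ i, Odd (r i)
  · left
    obtain ⟨i, hi⟩ := hodd
    rw [← abs_eq_zero, hpad.abs_homDensity_eq hU hanti, homDensity_disjUnion hU, abs_eq_zero,
      Finset.prod_eq_zero (Finset.mem_univ i)]
    rw [homDensity_directedPath hU, integral_iterate_odd hU hanti hi]
  · right
    push Not at hodd
    have : ∀ i, ∃ m, r i = 2 * m := fun i =>
      (Nat.not_odd_iff_even.mp (hodd i)).exists_two_nsmul _ |>.imp fun _ h => by simpa using h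
    choose n hn using this
    obtain rfl : r = fun i => 2 * n i := funext hn
    let e₀ : Fin (Fintype.card ι) ≃ ι := (Fintype.equivFin ι).symm
    let e : Fin (Fintype.card ι) ≃ ι := (Tuple.sort (n ∘ e₀)).trans e₀
    have hmono : Monotone (fun i => n (e i)) := Tuple.monotone_sort (n ∘ e₀)
    have hpad' := (isUPadding_disjUnion_Q n e).trans hpad
    have hn1 : ∀ i, 1 ≤ n i := fun i => by
      have : 1 ≤ 2 * n i := hr i
      omega
    have hsum : Fintype.card ι + ∑ i, 2 * n (e i) ≤ ℓ := by
      obtain ⟨f, -⟩ := hpad'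
      have hc := Fintype.card_le_of_embedding f
      rw [Fintype.card_sigma, ← Fintype.card_congr ψ, ZMod.card] at hc
      simpa [Finset.sum_add_distrib, add_comm] using hc
    refine ⟨Fintype.card ι, ?_, fun i => n (e i), ?_, hpad'⟩
    · by_contra hk
      have hemp : IsEmpty ι := Fintype.card_eq_zero_iff.mp (by omega)
      have hcard := hpad.card_edgeFinset_eq
      rw [edgeFinset_spanning C hF, card_edgeFinset_disjUnion, Finset.univ_eq_empty,
        Finset.sum_empty, Finset.card_eq_zero] at hcard
      exact h0 hcard
    · simp only [pathTuples, Finset.mem_filter, Fintype.mem_piFinset, Finset.mem_Icc]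
      refine ⟨fun i => ⟨hn1 _, ?_⟩, hmono, hsum⟩
      have : 2 * n (e i) ≤ ∑ i, 2 * n (e i) := Finset.single_le_sum
        (f := fun i => 2 * n (e i)) (fun _ _ => Nat.zero_le _) (Finset.mem_univ i)
      omega

theorem card_edgeFinset_cycle [NeZero ℓ] (hℓ : 3 ≤ ℓ) : C.edgeFinset.card = ℓ := by
  classical
  have : C.edgeFinset = Finset.univ.image (cycleEdge C ψ) := by
    ext e
    simp only [Finset.mem_image, Finset.mem_univ, true_and]
    refine ⟨exists_cycleEdge hψ, ?_⟩
    rintro ⟨a, rfl⟩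
    exact cycleEdge_mem hψ a
  rw [this, Finset.card_image_of_injective, Finset.card_univ, ZMod.card]
  intro a b h
  by_contra hab
  -- If 2 were 0 modulo ℓ, the steps from a to a + 1 and from a + 1 to a + 2 would be the same edge.
  have h2 : (2 : ZMod ℓ) ≠ 0 := by
    intro h
    have : ((2 : ℕ) : ZMod ℓ) = 0 := by exact_mod_cast h
    rw [ZMod.natCast_eq_zero_iff] at this
    exact absurd (Nat.le_of_dvd two_pos this) (by omega)
  unfold cycleEdge at h
  split_ifs at h <;> simp only [Prod.mk.injEq, EmbeddingLike.apply_eq_iff_eq] at h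
  · exact hab h.1
  · exact h2 (by linear_combination h.2 - h.1)
  · exact h2 (by linear_combination h.1 - h.2)
  · exact hab h.2

omit [Fintype V] in
theorem isUPadding_D {m : ℕ} (hm : 2 ≤ m) (h : ℓ = 2 * m) : (D m).IsUPadding C := by
  subst h
  have : NeZero (2 * m) := ⟨by omega⟩
  have hcast : ∀ a b : Fin (2 * m), ((b.val : ZMod (2 * m)) = a.val + 1) ↔
      b.val = a.val + 1 ∨ (b.val = 0 ∧ a.val + 1 = 2 * m) := by
    intro a b
    rw [show ((a.val : ZMod (2 * m)) + 1) = ((a.val + 1 : ℕ) : ZMod (2 * m)) by push_cast; rfl,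
      ZMod.natCast_eq_natCast_iff', Nat.mod_eq_of_lt b.2]
    rcases (show a.val + 1 < 2 * m ∨ a.val + 1 = 2 * m by omega) with h | h
    · rw [Nat.mod_eq_of_lt h]
      omega
    · rw [h, Nat.mod_self]
      omega
  have hinj : Function.Injective fun a : Fin (2 * m) => ψ (a.val : ZMod (2 * m)) := by
    intro a b h
    have h' := ψ.injective h
    rw [ZMod.natCast_eq_natCast_iff', Nat.mod_eq_of_lt a.2, Nat.mod_eq_of_lt b.2] at h'
    exact Fin.ext h'
  have hD : ∀ a b, C.UAdj (ψ (a.val : ZMod (2 * m))) (ψ (b.val : ZMod (2 * m))) ↔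
      (D m).UAdj a b := by
    intro a b
    rw [hψ, hcast, hcast]
    simp only [UAdj, D]
    omega
  refine ⟨⟨_, hinj⟩, fun v w => ?_⟩
  constructor
  · intro h
    have hsurj : ∀ v, ∃ a : Fin (2 * m), ψ (a.val : ZMod (2 * m)) = v := fun v => by
      obtain ⟨x, rfl⟩ := ψ.surjective v
      exact ⟨⟨x.val, x.val_lt⟩, by simp⟩
    obtain ⟨a, rfl⟩ := hsurj v
    obtain ⟨b, rfl⟩ := hsurj w
    exact ⟨a, b, rfl, rfl, (hD a b).mp h⟩
  · rintro ⟨a, b, rfl, rfl, h⟩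
    exact (hD a b).mpr h

end cycle

end OrientedGraph

/-! ### The expansion of the density of a cycle -/

namespace OrientedGraph

section expansion

variable {V : Type*} [Fintype V] {C : OrientedGraph V} {U : I → I → ℝ}

theorem homDensity_spanning {F : Finset (V × V)} (hF : F ⊆ C.edgeFinset) :
    (C.spanning F).homDensity U = ∫ x : V → I, ∏ e ∈ F, U (x e.1) (x e.2) := by
  rw [homDensity, edgeFinset_spanning C hF]

theorem homDensity_eq_sum_powerset {W : I → I → ℝ} (hU : IsKernel U)
    (hW : ∀ x y, W x y = U x y + 1 / 2) :
    C.homDensity W = ∑ F ∈ C.edgeFinset.powerset,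
      (C.spanning F).homDensity U / 2 ^ (C.edgeFinset.card - F.card) := by
  classical
  rw [homDensity]
  simp_rw [hW, Finset.prod_add]
  rw [integral_finsetSum]
  · refine Finset.sum_congr rfl fun F hF => ?_
    rw [homDensity_spanning (Finset.mem_powerset.mp hF), integral_mul_const, Finset.prod_const,
      Finset.card_sdiff_of_subset (Finset.mem_powerset.mp hF), one_div, inv_pow, div_eq_mul_inv]
  · intro F _
    exact ((IsBoundedMeasurable.prod F fun e _ => hU.comp (by fun_prop) (by fun_prop)).mul
      (.const _)).integrable _

/-- The tuples of path lengths which occur in a cycle of length `ℓ`. -/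
noncomputable def allPathTuples (ℓ : ℕ) : Finset (Σ k, Fin k → ℕ) :=
  (Finset.Icc 1 ℓ).sigma (pathTuples ℓ)

theorem mem_pathTuples {ℓ k : ℕ} {n : Fin k → ℕ} : n ∈ pathTuples ℓ k ↔
    (∀ i, 1 ≤ n i) ∧ Monotone n ∧ k + ∑ i, 2 * n i ≤ ℓ := by
  simp only [pathTuples, Finset.mem_filter, Fintype.mem_piFinset, Finset.mem_Icc]
  constructor
  · rintro ⟨h1, h2⟩
    exact ⟨fun i => (h1 i).1, h2⟩
  · rintro ⟨h1, h2, h3⟩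
    refine ⟨fun i => ⟨h1 i, ?_⟩, h2, h3⟩
    have : 2 * n i ≤ ∑ i, 2 * n i := Finset.single_le_sum
      (f := fun i => 2 * n i) (fun _ _ => Nat.zero_le _) (Finset.mem_univ i)
    omega

open scoped Classical in
/-- The sign with which `F` is counted in `α_C(2n₁, …, 2nₖ)`. -/
noncomputable def reversalSign (C : OrientedGraph V) (p : Σ k, Fin k → ℕ) (F : Finset (V × V)) :
    ℤ :=
  (if (C.spanning F).EvenReversalOf (disjUnion fun i => Q (p.2 i)) then 1 else 0) -
    if (C.spanning F).OddReversalOf (disjUnion fun i => Q (p.2 i)) then 1 else 0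

theorem alpha_eq_sum_reversalSign (p : Σ k, Fin k → ℕ) :
    C.alpha p.2 = ∑ F ∈ C.edgeFinset.powerset, C.reversalSign p F := by
  simp [alpha, reversalSign, Finset.sum_sub_distrib, Finset.sum_boole]

omit [Fintype V] in
theorem reversalSign_eq_zero {p : Σ k, Fin k → ℕ} {F : Finset (V × V)}
    (h : ¬ (disjUnion fun i => Q (p.2 i)).IsUPadding (C.spanning F)) : C.reversalSign p F = 0 := by
  rw [← evenReversalOf_or_oddReversalOf_iff, not_or] at h
  simp [reversalSign, h]

theorem alpha_eq_zero_of_card_lt {k : ℕ} {n : Fin k → ℕ}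
    (h : Fintype.card V < k + ∑ i, 2 * n i) : C.alpha n = 0 := by
  rw [alpha_eq_sum_reversalSign ⟨k, n⟩]
  refine Finset.sum_eq_zero fun F _ => reversalSign_eq_zero ?_
  rintro ⟨f, -⟩
  have hc := Fintype.card_le_of_embedding f
  rw [Fintype.card_sigma] at hc
  simp only [Fintype.card_fin, Finset.sum_add_distrib, Finset.sum_const, Finset.card_univ,
    smul_eq_mul, mul_one] at hc
  omega

theorem reversalSign_mul_prod (hU : IsKernel U) (hanti : ∀ x y, U x y = -U y x)
    {p : Σ k, Fin k → ℕ} {F : Finset (V × V)}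
    (h : (disjUnion fun i => Q (p.2 i)).IsUPadding (C.spanning F)) :
    (C.reversalSign p F : ℝ) * ∏ i, iterateNormSq U (p.2 i) = (C.spanning F).homDensity U := by
  have hprod : (disjUnion fun i => Q (p.2 i)).homDensity U = ∏ i, iterateNormSq U (p.2 i) := by
    rw [homDensity_disjUnion hU]
    exact Finset.prod_congr rfl fun i _ => homDensity_Q hU hanti _
  have heven := fun h => EvenReversalOf.homDensity_eq hU hanti (G := C.spanning F)
    (H := disjUnion fun i => Q (p.2 i)) h
  have hodd := fun h => OddReversalOf.homDensity_eq hU hanti (G := C.spanning F)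
    (H := disjUnion fun i => Q (p.2 i)) h
  rw [hprod] at heven hodd
  unfold reversalSign
  have h' := evenReversalOf_or_oddReversalOf_iff.mpr h
  split_ifs with h1 h2 h2
  -- If both parities occur, the density equals its own negative and vanishes, in agreement with the
  -- sign 1 - 1 = 0.
  · have e1 := heven h1
    have e2 := hodd h2
    push_cast
    linarith
  · rw [heven h1]
    simp
  · rw [hodd h2]
    simp
  · tauto

theorem card_of_isUPadding {p : Σ k, Fin k → ℕ} {F : Finset (V × V)} (hF : F ⊆ C.edgeFinset)
    (h : (disjUnion fun i => Q (p.2 i)).IsUPadding (C.spanning F)) :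
    F.card = ∑ i, 2 * p.2 i := by
  have := h.card_edgeFinset_eq
  rw [edgeFinset_spanning C hF, card_edgeFinset_disjUnion] at this
  simpa [card_edgeFinset_Q] using this

variable {ℓ : ℕ} [NeZero ℓ] {ψ : ZMod ℓ ≃ V}

/-- By uniqueness at most one tuple has a nonzero sign on F; if none fits, some run is odd and both
sides are zero. -/
theorem sum_reversalSign_eq (hψ : ∀ a b, C.UAdj (ψ a) (ψ b) ↔ b = a + 1 ∨ a = b + 1)
    (hU : IsKernel U) (hanti : ∀ x y, U x y = -U y x) {F : Finset (V × V)}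
    (hF : F ⊆ C.edgeFinset) (hne : F ≠ C.edgeFinset) (h0 : F ≠ ∅) :
    ∑ p ∈ allPathTuples ℓ, (C.reversalSign p F : ℝ) * (∏ i, iterateNormSq U (p.2 i)) /
      2 ^ (ℓ - ∑ i, 2 * p.2 i) = (C.spanning F).homDensity U / 2 ^ (ℓ - F.card) := by
  by_cases hex : ∃ p ∈ allPathTuples ℓ,
      (disjUnion fun i => Q (p.2 i)).IsUPadding (C.spanning F)
  · obtain ⟨p, hp, hpad⟩ := hex
    rw [Finset.sum_eq_single_of_mem p hp, reversalSign_mul_prod hU hanti hpad,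
      card_of_isUPadding hF hpad]
    intro q hq hqp
    rw [reversalSign_eq_zero fun hq' => hqp ?_]
    · simp
    · simp only [allPathTuples, Finset.mem_sigma, mem_pathTuples] at hp hq
      exact isUPadding_disjUnion_Q_unique hq.2.1 hp.2.1 hq.2.2.1 hp.2.2.1 hq' hpad
  · rcases homDensity_spanning_eq_zero_or hψ hU hanti hF hne h0 with h | ⟨k, hk, n, hn, hpad⟩
    · rw [h, zero_div]
      refine Finset.sum_eq_zero fun p hp => ?_
      rw [reversalSign_eq_zero fun h' => hex ⟨p, hp, h'⟩]
      simp
    · refine absurd ⟨⟨k, n⟩, ?_, hpad⟩ hex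
      have := (mem_pathTuples.mp hn).2.2
      have hkℓ : k ≤ ℓ := by omega
      exact Finset.mem_sigma.mpr ⟨Finset.mem_Icc.mpr ⟨hk, hkℓ⟩, hn⟩

omit [NeZero ℓ] in
-- A tuple with k ≥ 1 entries accounts for at least one edge and at most ℓ - k, so it matches
-- neither extreme set.
theorem sum_reversalSign_eq_zero (hcard : C.edgeFinset.card = ℓ) {F : Finset (V × V)}
    (h : F = C.edgeFinset ∨ F = ∅) :
    ∑ p ∈ allPathTuples ℓ, (C.reversalSign p F : ℝ) * (∏ i, iterateNormSq U (p.2 i)) /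
      2 ^ (ℓ - ∑ i, 2 * p.2 i) = 0 := by
  refine Finset.sum_eq_zero fun p hp => ?_
  rw [reversalSign_eq_zero]
  · simp
  · intro hpad
    simp only [allPathTuples, Finset.mem_sigma, Finset.mem_Icc, mem_pathTuples] at hp
    have hF : F ⊆ C.edgeFinset := by rcases h with rfl | rfl <;> simp
    have hc := card_of_isUPadding hF hpad
    rcases h with rfl | rfl
    · omega
    · have hle : ∑ _i : Fin p.1, 1 ≤ ∑ i, 2 * p.2 i := Finset.sum_le_sum fun i _ => by
        have := hp.2.1 i
        omega
      simp at hle hc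
      omega

theorem homDensity_cycle_eq (hψ : ∀ a b, C.UAdj (ψ a) (ψ b) ↔ b = a + 1 ∨ a = b + 1)
    (hℓ : 3 ≤ ℓ) (hU : IsKernel U) (hanti : ∀ x y, U x y = -U y x) {W : I → I → ℝ}
    (hW : ∀ x y, W x y = U x y + 1 / 2) :
    C.homDensity W = 1 / 2 ^ ℓ + C.homDensity U + ∑ p ∈ allPathTuples ℓ,
      (C.alpha p.2 : ℝ) * (∏ i, iterateNormSq U (p.2 i)) / 2 ^ (ℓ - ∑ i, 2 * p.2 i) := by
  classical
  have hcard := card_edgeFinset_cycle hψ hℓ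
  have hne : (∅ : Finset (V × V)) ≠ C.edgeFinset := fun h => by
    rw [← h, Finset.card_empty] at hcard
    omega
  have hterm : ∀ F ∈ C.edgeFinset.powerset,
      (C.spanning F).homDensity U / 2 ^ (C.edgeFinset.card - F.card) =
        ((if F = ∅ then 1 / 2 ^ ℓ else 0) + if F = C.edgeFinset then C.homDensity U else 0) +
        ∑ p ∈ allPathTuples ℓ, (C.reversalSign p F : ℝ) * (∏ i, iterateNormSq U (p.2 i)) /
          2 ^ (ℓ - ∑ i, 2 * p.2 i) := by
    intro F hF
    rw [Finset.mem_powerset] at hF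
    rw [hcard]
    by_cases h0 : F = ∅
    · rw [sum_reversalSign_eq_zero hcard (Or.inr h0), homDensity_spanning hF]
      subst h0
      simp [hne]
    · by_cases h1 : F = C.edgeFinset
      · rw [sum_reversalSign_eq_zero hcard (Or.inl h1), homDensity_spanning hF]
        subst h1
        rw [if_neg h0, if_pos rfl, hcard, homDensity]
        simp
      · rw [sum_reversalSign_eq hψ hU hanti hF h1 h0]
        simp [h0, h1]
  rw [homDensity_eq_sum_powerset hU hW, Finset.sum_congr rfl hterm, Finset.sum_add_distrib,
    Finset.sum_add_distrib, Finset.sum_ite_eq_of_mem' _ _ _ (Finset.empty_mem_powerset _),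
    Finset.sum_ite_eq_of_mem' _ _ _ (Finset.mem_powerset_self _), Finset.sum_comm]
  congr 1
  refine Finset.sum_congr rfl fun p _ => ?_
  rw [← Finset.sum_div, ← Finset.sum_mul, alpha_eq_sum_reversalSign]
  push_cast
  rfl

end expansion

theorem sum_pathTuples_one {ℓ : ℕ} (hℓ : Even ℓ) (g : (Fin 1 → ℕ) → ℝ) :
    ∑ n ∈ pathTuples ℓ 1, g n = ∑ m ∈ Finset.Icc 1 (ℓ / 2 - 1), g ![m] := by
  have hsingle : ∀ n : Fin 1 → ℕ, ![n 0] = n := fun n => by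
    ext i
    rw [Subsingleton.elim i 0]
    rfl
  refine Finset.sum_bij' (fun n _ => n 0) (fun m _ => ![m]) ?_ ?_ ?_ ?_ ?_
  · intro n hn
    obtain ⟨h1, -, h2⟩ := mem_pathTuples.mp hn
    simp only [Fin.sum_univ_one] at h2
    have := h1 0
    rw [Finset.mem_Icc]
    obtain ⟨a, rfl⟩ := hℓ
    omega
  · intro m hm
    rw [Finset.mem_Icc] at hm
    refine mem_pathTuples.mpr ⟨fun i => by simpa using hm.1, Subsingleton.monotone _, ?_⟩
    simp
    omega
  · exact fun n _ => hsingle n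
  · exact fun m _ => rfl
  · exact fun n _ => by rw [hsingle]

/-- Single paths have 1 ≤ m ≤ ℓ/2 - 1, and m = 1 drops out. For ℓ = 4 this range does not contain m
= 2, so the displayed term at 2 has to vanish by itself. -/
theorem sum_allPathTuples {ℓ : ℕ} (hℓ : Even ℓ) (h4 : 4 ≤ ℓ) (g : ∀ k, (Fin k → ℕ) → ℝ)
    (h1 : g 1 ![1] = 0) (h2 : ℓ = 4 → g 1 ![2] = 0) :
    ∑ p ∈ allPathTuples ℓ, g p.1 p.2 = g 1 ![2] + ∑ m ∈ Finset.Icc 3 (ℓ / 2 - 1), g 1 ![m] +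
      ∑ k ∈ Finset.Icc 2 ℓ, ∑ n ∈ pathTuples ℓ k, g k n := by
  rw [allPathTuples, Finset.sum_sigma, ← Finset.add_sum_Ioc_eq_sum_Icc (by omega),
    sum_pathTuples_one hℓ]
  congr 1
  rcases (show ℓ = 4 ∨ 6 ≤ ℓ by obtain ⟨a, rfl⟩ := hℓ; omega) with rfl | h6
  · simp [h1, h2]
  · rw [← Finset.add_sum_Ioc_eq_sum_Icc (by omega), h1, zero_add]
    change ∑ m ∈ Finset.Icc 2 _, _ = _
    rw [← Finset.add_sum_Ioc_eq_sum_Icc (by omega)]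
    rfl

/-! ### The main inequality -/

/-- Only a negative coefficient needs the upper bound on q; a nonnegative one is discarded. In use,
s is ‖T²1‖² and q a product of path densities. -/
theorem min_div_mul_le {a q s P X : ℝ} (hP : 0 < P) (hX : 0 < X) (hq : 0 ≤ q) (hqs : q ≤ s / P) :
    s * (min 0 a / (P * X)) ≤ a * q / X := by
  have h1 : min 0 a * (s / P) ≤ min 0 a * q :=
    mul_le_mul_of_nonpos_left hqs (min_le_left _ _)
  have h2 : min 0 a * q ≤ a * q := mul_le_mul_of_nonneg_right (min_le_right _ _) hq
  calc s * (min 0 a / (P * X)) = min 0 a * (s / P) / X := by field_simp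
    _ ≤ a * q / X := div_le_div_of_nonneg_right (h1.trans h2) hX.le

section inequality

variable {U : I → I → ℝ} (hU : IsKernel U) (hanti : ∀ x y, U x y = -U y x)
  (hhalf : ∀ x y, |U x y| ≤ 1 / 2)

include hU hanti hhalf

/-- Every factor is reduced to t_1 = ‖T1‖² at the price of powers of π². Two of the k factors t_1
are spent on t_1² ≤ t_2, and the remaining k - 2 are bounded by 1/12 each. -/
theorem prod_iterateNormSq_le {k : ℕ} (hk : 2 ≤ k) {n : Fin k → ℕ} (hn : ∀ i, 1 ≤ n i) :
    ∏ i, iterateNormSq U (n i) ≤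
      iterateNormSq U 2 / (12 ^ (k - 2) * Real.pi ^ ((∑ i, 2 * n i) - 2 * k)) := by
  have hpi := Real.pi_pos
  have h0 := iterateNormSq_nonneg (U := U)
  have hexp : (∑ i, 2 * n i) - 2 * k = ∑ i, 2 * (n i - 1) := by
    have : ∑ i, 2 * n i = ∑ i, 2 * (n i - 1) + ∑ _i : Fin k, 2 := by
      rw [← Finset.sum_add_distrib]
      refine Finset.sum_congr rfl fun i _ => ?_
      have := hn i
      omega
    rw [this]
    simp
    omega
  calc ∏ i, iterateNormSq U (n i) ≤
        ∏ i, iterateNormSq U 1 / Real.pi ^ (2 * (n i - 1)) := by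
        refine Finset.prod_le_prod (fun i _ => h0 _) fun i _ => ?_
        have := iterateNormSq_add_le hU hanti hhalf 1 (n i - 1)
        rwa [Nat.add_sub_cancel' (hn i)] at this
    _ = iterateNormSq U 1 ^ (k - 2) * iterateNormSq U 1 ^ 2 /
          Real.pi ^ ((∑ i, 2 * n i) - 2 * k) := by
        rw [Finset.prod_div_distrib, Finset.prod_pow_eq_pow_sum, hexp, ← pow_add,
          Nat.sub_add_cancel hk]
        simp
    _ ≤ (1 / 12) ^ (k - 2) * iterateNormSq U 2 / Real.pi ^ ((∑ i, 2 * n i) - 2 * k) := by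
        gcongr
        · exact h0 1
        · exact iterateNormSq_one_le hU hanti hhalf
        · exact iterateNormSq_one_sq_le hU hanti
    _ = _ := by
        rw [one_div, inv_pow]
        field_simp

/-- The coefficients a are left free so that both α_C and -α_C can be inserted. Multiplying the
hypothesis by t_2 = ‖T²1‖² ≥ 0 gives a lower bound for the path sum, term by term. -/
theorem sum_mul_prod_nonneg {ℓ : ℕ} (hℓ : Even ℓ) (h4 : 4 ≤ ℓ) (a : ∀ k, (Fin k → ℕ) → ℝ)
    (h1 : a 1 ![1] = 0) (h2 : ℓ = 4 → a 1 ![2] = 0)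
    (h : 0 ≤ a 1 ![2] / 2 ^ (ℓ - 4)
      + ∑ m ∈ Finset.Icc 3 (ℓ / 2 - 1),
          min 0 (a 1 ![m]) / (Real.pi ^ (2 * m - 4) * 2 ^ (ℓ - 2 * m))
      + ∑ k ∈ Finset.Icc 2 ℓ, ∑ n ∈ pathTuples ℓ k, min 0 (a k n) /
          (12 ^ (k - 2) * Real.pi ^ ((∑ i, 2 * n i) - 2 * k) * 2 ^ (ℓ - ∑ i, 2 * n i))) :
    0 ≤ ∑ p ∈ allPathTuples ℓ,
      a p.1 p.2 * (∏ i, iterateNormSq U (p.2 i)) / 2 ^ (ℓ - ∑ i, 2 * p.2 i) := by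
  have hpi := Real.pi_pos
  have h0 := iterateNormSq_nonneg (U := U)
  rw [sum_allPathTuples hℓ h4 (fun k n => a k n * (∏ i, iterateNormSq U (n i)) /
    2 ^ (ℓ - ∑ i, 2 * n i)) (by simp [h1]) (fun h => by simp [h2 h])]
  refine (mul_nonneg (h0 2) h).trans ?_
  rw [mul_add, mul_add, Finset.mul_sum, Finset.mul_sum]
  refine add_le_add (add_le_add ?_ (Finset.sum_le_sum fun m hm => ?_))
    (Finset.sum_le_sum fun k hk => ?_)
  · refine le_of_eq ?_
    simp
    ring
  · rw [Finset.mem_Icc] at hm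
    simp only [Fin.prod_univ_one, Fin.sum_univ_one, Matrix.cons_val_fin_one]
    refine min_div_mul_le (by positivity) (by positivity) (h0 _) ?_
    have := iterateNormSq_add_le hU hanti hhalf 2 (m - 2)
    rwa [Nat.add_sub_cancel' (by omega), Nat.mul_sub] at this
  · rw [Finset.mul_sum]
    refine Finset.sum_le_sum fun n hn => ?_
    exact min_div_mul_le (by positivity) (by positivity) (Finset.prod_nonneg fun i _ => h0 _)
      (prod_iterateNormSq_le hU hanti hhalf (Finset.mem_Icc.mp hk).1 (mem_pathTuples.mp hn).1)

end inequality

end OrientedGraph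

/-! ### The theorem, for both values of γ_C -/

theorem mainTheorem5 {V : Type*} [Fintype V] (C : OrientedGraph V) (ℓ : ℕ)
    (hC : C.IsCycleOrientation ℓ) (hℓ : Even ℓ) :
    (C.gamma = 1 → C.alpha ![1] = 0 →
      0 ≤ (C.alpha ![2] : ℝ) / 2 ^ (ℓ - 4)
          + ∑ m ∈ Finset.Icc 3 (ℓ / 2 - 1),
              min 0 (C.alpha ![m] : ℝ) / (Real.pi ^ (2 * m - 4) * 2 ^ (ℓ - 2 * m))
          + ∑ k ∈ Finset.Icc 2 ℓ, ∑ n ∈ pathTuples ℓ k,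
              min 0 (C.alpha n : ℝ) /
                (12 ^ (k - 2) * Real.pi ^ ((∑ i, 2 * n i) - 2 * k) * 2 ^ (ℓ - ∑ i, 2 * n i)) →
      C.QuasirandomForcing) ∧
    (C.gamma = -1 → C.alpha ![1] = 0 →
      (C.alpha ![2] : ℝ) / 2 ^ (ℓ - 4)
          + ∑ m ∈ Finset.Icc 3 (ℓ / 2 - 1),
              max 0 (C.alpha ![m] : ℝ) / (Real.pi ^ (2 * m - 4) * 2 ^ (ℓ - 2 * m))
          + ∑ k ∈ Finset.Icc 2 ℓ, ∑ n ∈ pathTuples ℓ k,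
              max 0 (C.alpha n : ℝ) /
                (12 ^ (k - 2) * Real.pi ^ ((∑ i, 2 * n i) - 2 * k) * 2 ^ (ℓ - ∑ i, 2 * n i)) ≤ 0 →
      C.QuasirandomForcing) := by
  have h3 := hC.1
  have : NeZero ℓ := ⟨by omega⟩
  obtain ⟨ψ, hψ⟩ := hC.exists_equiv
  obtain ⟨k, hk, rfl⟩ : ∃ k, 1 ≤ k ∧ ℓ = 2 * (k + 1) := by
    obtain ⟨a, rfl⟩ := hℓ
    exact ⟨a - 1, by omega, by omega⟩
  have hcV : Fintype.card V = 2 * (k + 1) := by rw [← Fintype.card_congr ψ, ZMod.card]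
  have hpad : (OrientedGraph.D (k + 1)).IsUPadding C :=
    OrientedGraph.isUPadding_D hψ (by omega) rfl
  have hgamma : C.gamma = 1 ↔ C.EvenReversalOf (OrientedGraph.D (k + 1)) := by
    have h : Fintype.card V / 2 = k + 1 := by omega
    rw [OrientedGraph.gamma, h]
    split_ifs with h' <;> simp [h']
  -- The path Q_4 has five vertices and does not fit into a 4-cycle.
  have hα2 : 2 * (k + 1) = 4 → C.alpha ![2] = 0 := fun h =>
    OrientedGraph.alpha_eq_zero_of_card_lt (by rw [hcV, h]; simp)
  -- Here s plays the role of γ_C; multiplying the coefficients by s reduces the case γ_C = -1 to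
  -- the form of the other.
  have key : ∀ s : ℝ, s = 1 ∨ s = -1 → C.alpha ![1] = 0 →
      (∀ U : I → I → ℝ, IsKernel U → (∀ x y, U x y = -U y x) →
        C.homDensity U = s * (OrientedGraph.D (k + 1)).homDensity U) →
      0 ≤ s * (C.alpha ![2] : ℝ) / 2 ^ (2 * (k + 1) - 4)
          + ∑ m ∈ Finset.Icc 3 (2 * (k + 1) / 2 - 1),
              min 0 (s * (C.alpha ![m] : ℝ)) /
                (Real.pi ^ (2 * m - 4) * 2 ^ (2 * (k + 1) - 2 * m))
          + ∑ j ∈ Finset.Icc 2 (2 * (k + 1)), ∑ n ∈ pathTuples (2 * (k + 1)) j,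
              min 0 (s * (C.alpha n : ℝ)) /
                (12 ^ (j - 2) * Real.pi ^ ((∑ i, 2 * n i) - 2 * j) *
                  2 ^ (2 * (k + 1) - ∑ i, 2 * n i)) →
      C.QuasirandomForcing := by
    intro s hs hα1 hD hineq W hW hdens
    let U : I → I → ℝ := fun x y => W x y - 1 / 2
    have hhalf : ∀ x y, |U x y| ≤ 1 / 2 := fun x y => by
      have h1 := hW.nonneg x y
      have h2 := hW.nonneg y x
      have h3 := hW.add_swap x y
      exact abs_le.mpr ⟨by simp only [U]; linarith, by simp only [U]; linarith⟩
    have hU : IsKernel U := ⟨hW.measurable.sub_const _, 1 / 2, hhalf⟩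
    have hanti : ∀ x y, U x y = -U y x := fun x y => by
      have := hW.add_swap x y
      simp only [U]
      linarith
    have hexp := OrientedGraph.homDensity_cycle_eq hψ h3 hU hanti (W := W)
      (fun x y => by simp only [U]; ring)
    have hS := OrientedGraph.sum_mul_prod_nonneg hU hanti hhalf hℓ (by omega)
      (fun k n => s * (C.alpha n : ℝ)) (by simp [hα1]) (fun h => by simp [hα2 h]) hineq
    simp only [mul_assoc, mul_div_assoc, ← Finset.mul_sum] at hS hexp
    rw [hdens, OrientedGraph.card_edgeFinset_cycle hψ h3, hD U hU hanti] at hexp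
    have hnn : 0 ≤ (OrientedGraph.D (k + 1)).homDensity U := by
      rw [OrientedGraph.homDensity_D hU hanti hk]
      exact integral_nonneg fun x => integral_nonneg fun y => sq_nonneg _
    -- With S the path sum, the expansion has become 0 = s t(D_ℓ,U) + S, where t(D_ℓ,U) ≥ 0 and sS ≥
    -- 0.
    have hzero : (OrientedGraph.D (k + 1)).homDensity U = 0 := by
      rcases hs with rfl | rfl <;> linarith
    rw [OrientedGraph.homDensity_D hU hanti hk] at hzero
    exact hW.ae_eq_half fun v hv => kernelOp_ae_eq_zero_of_kernelPow hU hanti k hzero hv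
  constructor
  · intro hγ hα1 hineq
    have heven := hgamma.mp hγ
    refine key 1 (Or.inl rfl) hα1 (fun U hU hanti => ?_) (by simpa only [one_mul] using hineq)
    rw [heven.homDensity_eq hU hanti, one_mul]
  · intro hγ hα1 hineq
    -- C and D_ℓ have the same underlying cycle, so one parity occurs, and γ_C = -1 excludes the
    -- even one.
    have hodd : C.OddReversalOf (OrientedGraph.D (k + 1)) := by
      refine (OrientedGraph.evenReversalOf_or_oddReversalOf_iff.mpr hpad).resolve_left fun h => ?_
      rw [hgamma.mpr h] at hγ
      norm_num at hγ
    refine key (-1) (Or.inr rfl) hα1 (fun U hU hanti => ?_) ?_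
    · rw [hodd.homDensity_eq hU hanti, neg_one_mul]
    · have hmin : ∀ x : ℝ, min 0 (-1 * x) = -max 0 x := fun x => by
        rw [neg_one_mul, ← min_neg_neg, neg_zero]
      simp only [hmin, neg_div, Finset.sum_neg_distrib]
      rw [neg_one_mul, neg_div]
      linarith
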